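/- Let $k$ be an arbitrary field and let $\mathcal C$ be an additive $k$-category (morphism sets are $k$-vector spaces, composition is $k$-bilinear) which is Hom-finite (all morphism spaces are finite dimensional over $k$) and Krull-Schmidt (every nonzero object is a finite direct sum of objects with local endomorphism algebra). Write $\mathrm{rad}$ for the Jacobson radical of $\mathcal C$. For indecomposable $X$, the automorphism field of $X$ is the division algebra $k_X=\mathrm{End}(X)/\mathrm{rad}(X,X)$; it is trivial if $k_X\cong k$. A morphism $f:X\to Y$ is a source morphism if it is not a section, every non-section $X\to M$ factors through $f$, and every endomorphism $h$ of $Y$ with $hf=f$ is an automorphism; sink morphisms are defined dually. A sequence $X\xrightarrow{f}Y\xrightarrow{g}Z$ with $Y\neq 0$ is almost split if $f$ is a source morphism and a pseudo-kernel of $g$, and $g$ is a sink morphism and a pseudo-cokernel of $f$. The Auslander-Reiten quiver $\Gamma_{\mathcal C}$ has as vertices a complete set of representatives of the isomorphism classes of indecomposable objects. With $\mathrm{irr}(X,Y)=\mathrm{rad}(X,Y)/\mathrm{rad}^2(X,Y)$, and $d_{XY}$, $d'_{XY}$ its dimensions over $k_Y$ and $k_X$ respectively, there is an arrow $X\to Y$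 with valuation $(d_{XY},d'_{XY})$ if and only if $d_{XY}>0$; an arrow with symmetric valuation $(d,d)$ is replaced by $d$ unvalued arrows. The translation is given by $\tau Z=X$ if and only if there is an almost split sequence $X\to Y\to Z$. A connected component $\Gamma$ of $\Gamma_{\mathcal C}$ is standard if all its objects have trivial automorphism field and there is a $k$-linear equivalence, acting identically on the objects, from the mesh category $k(\Gamma)$ (the path category of $\Gamma$ over $k$ modulo the ideal generated by the mesh relations $\sum_i\beta_i\alpha_i$, one for each $Z$ for which $\tau Z$ is defined, where the $\alpha_i:\tau Z\to Y_i$ are the arrows starting in $\tau Z$ and the $\beta_i:Y_i\to Z$ the arrows ending in $Z$) to the full subcategory of $\mathcal C$ generated by the objects of $\Gamma$. A brick is an object $X$ with $\mathrm{End}(X)\cong k$ as $k$-algebras; $X$ and $Y$ are orthogonal if $\mathrm{Hom}(X,Y)=0=\mathrm{Hom}(Y,X)$. For a quiver $\Delta$ without oriented cycles, $\mathbb Z\Delta$ has the vertices $(n,x)$ with $n\in\mathbb Z$ and $x\in\Delta$, the arrows $(n,x)\to(n,y)$ and $(n,y)\to(n+1,x)$ for each arrow $x\to y$ of $\Delta$,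 and $\tau(n,x)=(n-1,x)$; $\mathbb N\Delta$ and $\mathbb N^-\Delta$ are the full translation subquivers on the vertices with $n\ge0$ and with $n\le 0$ respectively. Let $\mathbb A_\infty^+$ be the quiver $0\to1\to2\to\cdots$ and $\mathbb A_\infty^-$ the quiver $\cdots\to2\to1\to0$; $\mathbb Z\mathbb A_\infty$ is, up to isomorphism, independent of the orientation of $\mathbb A_\infty$. A wing of rank $n\ge1$ is a trivially valued translation quiver isomorphic to the full translation subquiver of $\mathbb Z\mathbb A_\infty^+$ on the vertices $(m,i)$ with $m\ge0$, $i\ge 0$, $m+i<n$; its quasi-simple vertices are those at the bottom, that is, those with $i=0$. If $\Gamma$ is of shape $\mathbb Z\mathbb A_\infty$, $\mathbb N\mathbb A_\infty^+$ or $\mathbb N^-\mathbb A_\infty^-$ (isomorphic to it as a translation quiver, with unvalued single arrows), its quasi-simple objects are those having at most one immediate predecessor and at most one immediate successor in $\Gamma$. **Theorem.** Let $\Gamma$ be a connected component of $\Gamma_{\mathcal C}$ which is a wing or of shape $\mathbb Z\mathbb A_\infty$, $\mathbb N\mathbb A_\infty^+$ or $\mathbb N^-\mathbb A_\infty^-$.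 Then $\Gamma$ is standard if and only if its quasi-simple objects are pairwise orthogonal bricks. -/

import Mathlib

open CategoryTheory CategoryTheory.Limits

universe w v u

namespace AR

section Basic

variable (k : Type w) [Field k] {C : Type u} [Category.{v} C] [Preadditive C] [Linear k C]

/-- A nonzero object is always a finite direct sum of objects with local endomorphism algebra. -/
def IsKrullSchmidt (C : Type u) [Category.{v} C] [Preadditive C] [HasFiniteBiproducts C] : Prop :=
  ∀ X : C, ¬ IsZero X → ∃ (n : ℕ) (Y : Fin n → C),
    (∀ i, IsLocalRing (End (Y i))) ∧ Nonempty (X ≅ ⨁ Y)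

/-- Two objects are orthogonal if there are no nonzero morphisms between them, either way. -/
def Orthogonal (X Y : C) : Prop :=
  (∀ f : X ⟶ Y, f = 0) ∧ (∀ f : Y ⟶ X, f = 0)

/-- An object whose endomorphism algebra is trivial, that is, isomorphic to `k`. -/
def IsBrick (X : C) : Prop :=
  Nonempty (End X ≃ₐ[k] k)

/-! ### The radical of the category -/

/-- Morphisms in the Jacobson radical of the category. -/
def IsRadical {X Y : C} (f : X ⟶ Y) : Prop :=
  ∀ g : Y ⟶ X, IsIso (𝟙 X - f ≫ g)

lemma isIso_one_sub_swap {X Y : C} (f : X ⟶ Y) (g : Y ⟶ X) (h : IsIso (𝟙 X - f ≫ g)) :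
    IsIso (𝟙 Y - g ≫ f) := by
  obtain ⟨a, h1, h2⟩ := h.out
  refine ⟨𝟙 Y + g ≫ a ≫ f, ?_, ?_⟩
  · have : f ≫ g ≫ a = a - 𝟙 X := by
      rw [Preadditive.sub_comp, Category.id_comp, Category.assoc] at h1
      rw [← h1]; abel
    have h3 : f ≫ g ≫ a ≫ f = a ≫ f - f := by
      simpa using congrArg (fun t => t ≫ f) this
    simp only [Preadditive.sub_comp, Preadditive.comp_add, Category.comp_id, Category.id_comp,
      Category.assoc, h3, Preadditive.comp_sub]
    abel
  · have : a ≫ f ≫ g = a - 𝟙 X := by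
      rw [Preadditive.comp_sub, Category.comp_id] at h2
      rw [← h2]; abel
    have h3 : a ≫ f ≫ g ≫ f = a ≫ f - f := by
      simpa using congrArg (fun t => t ≫ f) this
    simp only [Preadditive.add_comp, Preadditive.comp_sub, Category.comp_id, Category.id_comp,
      Category.assoc, h3]
    abel

lemma IsRadical.comp_right {X Y Z : C} {f : X ⟶ Y} (hf : IsRadical f) (h : Y ⟶ Z) :
    IsRadical (f ≫ h) := by
  intro g
  rw [Category.assoc]
  exact hf (h ≫ g)

lemma IsRadical.comp_left {X Y Z : C} {f : Y ⟶ Z} (hf : IsRadical f) (h : X ⟶ Y) :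
    IsRadical (h ≫ f) := by
  intro g
  rw [Category.assoc]
  apply isIso_one_sub_swap (f ≫ g) h
  rw [Category.assoc]
  exact hf (g ≫ h)

lemma isRadical_zero (X Y : C) : IsRadical (0 : X ⟶ Y) := by
  intro g
  simp only [zero_comp, sub_zero]
  infer_instance

lemma IsRadical.add {X Y : C} {f₁ f₂ : X ⟶ Y} (h₁ : IsRadical f₁) (h₂ : IsRadical f₂) :
    IsRadical (f₁ + f₂) := by
  intro g
  have := h₁ g
  have := h₂ (g ≫ inv (𝟙 X - f₁ ≫ g))
  have : 𝟙 X - (f₁ + f₂) ≫ g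
      = (𝟙 X - f₂ ≫ g ≫ inv (𝟙 X - f₁ ≫ g)) ≫ (𝟙 X - f₁ ≫ g) := by
    rw [Preadditive.sub_comp, Category.id_comp, Category.assoc, Category.assoc,
      IsIso.inv_hom_id, Category.comp_id, Preadditive.add_comp]
    abel
  rw [this]
  infer_instance

lemma IsRadical.smul {X Y : C} {f : X ⟶ Y} (h : IsRadical f) (c : k) : IsRadical (c • f) := by
  have : c • f = f ≫ (c • 𝟙 Y) := by simp
  rw [this]
  exact h.comp_right _

/-- `rad(X, Y)`. -/
def rad (X Y : C) : Submodule k (X ⟶ Y) where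
  carrier := {f | IsRadical f}
  add_mem' h₁ h₂ := h₁.add h₂
  zero_mem' := isRadical_zero X Y
  smul_mem' c _ h := h.smul k c

/-- `rad²(X, Y)`: sums of composites of two radical morphisms. -/
def radSq (X Y : C) : Submodule k (X ⟶ Y) :=
  Submodule.span k {h | ∃ (Z : C) (f : X ⟶ Z) (g : Z ⟶ Y), IsRadical f ∧ IsRadical g ∧ h = f ≫ g}

/-- `rad(X, X)` as an ideal of the endomorphism ring. -/
def radIdeal (X : C) : Ideal (End X) where
  carrier := {f | IsRadical (X := X) (Y := X) f}
  add_mem' h₁ h₂ := IsRadical.add (C := C) h₁ h₂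
  zero_mem' := isRadical_zero X X
  smul_mem' c _ h := IsRadical.comp_right (C := C) h c

instance (X : C) : (radIdeal X).IsTwoSided where
  mul_mem_of_left c h := IsRadical.comp_left (C := C) h c

/-- The automorphism field `End(X) / rad(X, X)` (a division algebra if `X` is indecomposable
in a Krull-Schmidt category). -/
abbrev AutField (X : C) : Type v := End X ⧸ radIdeal X

/-- The automorphism field is isomorphic to `k`. -/
def HasTrivialAutField (X : C) : Prop :=
  Nonempty (AutField X ≃ₐ[k] k)

/-- `irr(X, Y) = rad(X, Y) / rad²(X, Y)`. -/
abbrev Irr (X Y : C) : Type v := rad k X Y ⧸ (radSq k X Y).submoduleOf (rad k X Y)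

lemma radSq_comp_right {X Y Z : C} (φ : Y ⟶ Z) {f : X ⟶ Y} (hf : f ∈ radSq k X Y) :
    f ≫ φ ∈ radSq k X Z := by
  have : radSq k X Y ≤ (radSq k X Z).comap (Linear.rightComp k X φ) := by
    refine Submodule.span_le.2 ?_
    rintro _ ⟨W, a, b, ha, hb, rfl⟩
    exact Submodule.subset_span ⟨W, a, b ≫ φ, ha, hb.comp_right φ, by simp⟩
  exact this hf

lemma radSq_comp_left {X Y Z : C} (φ : X ⟶ Y) {f : Y ⟶ Z} (hf : f ∈ radSq k Y Z) :
    φ ≫ f ∈ radSq k X Z := by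
  have : radSq k Y Z ≤ (radSq k X Z).comap (Linear.leftComp k Z φ) := by
    refine Submodule.span_le.2 ?_
    rintro _ ⟨W, a, b, ha, hb, rfl⟩
    exact Submodule.subset_span ⟨W, φ ≫ a, b, ha.comp_left φ, hb, by simp⟩
  exact this hf

/-- Composition with `φ : Y ⟶ Y` on the target side, as an endomorphism of `irr(X, Y)`. -/
def irrPost (X Y : C) (φ : Y ⟶ Y) : Irr k X Y →ₗ[k] Irr k X Y :=
  Submodule.mapQ _ _
    ((Linear.rightComp k X φ).restrict (p := rad k X Y) (q := rad k X Y)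
      (fun _ hf => IsRadical.comp_right hf φ))
    (fun f hf => radSq_comp_right k φ (f := f.1) hf)

/-- Composition with `φ : X ⟶ X` on the source side, as an endomorphism of `irr(X, Y)`. -/
def irrPre (X Y : C) (φ : X ⟶ X) : Irr k X Y →ₗ[k] Irr k X Y :=
  Submodule.mapQ _ _
    ((Linear.leftComp k Y φ).restrict (p := rad k X Y) (q := rad k X Y)
      (fun _ hf => IsRadical.comp_left hf φ))
    (fun f hf => radSq_comp_left k φ (f := f.1) hf)

lemma irrPost_mk (X Y : C) (φ : Y ⟶ Y) (f : rad k X Y) :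
    irrPost k X Y φ (Submodule.Quotient.mk f)
      = Submodule.Quotient.mk ⟨f.1 ≫ φ, IsRadical.comp_right f.2 φ⟩ := rfl

lemma irrPre_mk (X Y : C) (φ : X ⟶ X) (f : rad k X Y) :
    irrPre k X Y φ (Submodule.Quotient.mk f)
      = Submodule.Quotient.mk ⟨φ ≫ f.1, IsRadical.comp_left f.2 φ⟩ := rfl

/-- `End(Y)` acts on `irr(X, Y)` by composition on the target side. -/
def irrPostHom (X Y : C) : End Y →+* Module.End k (Irr k X Y) where
  toFun φ := irrPost k X Y φ
  map_one' := by
    refine LinearMap.ext fun f => ?_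
    obtain ⟨f, rfl⟩ := Submodule.Quotient.mk_surjective _ f
    exact congrArg Submodule.Quotient.mk (Subtype.ext (Category.comp_id f.1))
  map_mul' a b := by
    refine LinearMap.ext fun f => ?_
    obtain ⟨f, rfl⟩ := Submodule.Quotient.mk_surjective _ f
    exact congrArg Submodule.Quotient.mk (Subtype.ext (Category.assoc f.1 b a).symm)
  map_zero' := by
    refine LinearMap.ext fun f => ?_
    obtain ⟨f, rfl⟩ := Submodule.Quotient.mk_surjective _ f
    exact congrArg Submodule.Quotient.mk (Subtype.ext (comp_zero (f := f.1)))
  map_add' a b := by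
    refine LinearMap.ext fun f => ?_
    obtain ⟨f, rfl⟩ := Submodule.Quotient.mk_surjective _ f
    exact congrArg Submodule.Quotient.mk (Subtype.ext (Preadditive.comp_add _ _ _ f.1 a b))

/-- `End(X)` acts on `irr(X, Y)` from the right by composition on the source side. -/
def irrPreHom (X Y : C) : End X →+* (Module.End k (Irr k X Y))ᵐᵒᵖ where
  toFun φ := MulOpposite.op (irrPre k X Y φ)
  map_one' := by
    refine MulOpposite.unop_injective (LinearMap.ext fun f => ?_)
    obtain ⟨f, rfl⟩ := Submodule.Quotient.mk_surjective _ f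
    exact congrArg Submodule.Quotient.mk (Subtype.ext (Category.id_comp f.1))
  map_mul' a b := by
    refine MulOpposite.unop_injective (LinearMap.ext fun f => ?_)
    obtain ⟨f, rfl⟩ := Submodule.Quotient.mk_surjective _ f
    exact congrArg Submodule.Quotient.mk (Subtype.ext (Category.assoc b a f.1))
  map_zero' := by
    refine MulOpposite.unop_injective (LinearMap.ext fun f => ?_)
    obtain ⟨f, rfl⟩ := Submodule.Quotient.mk_surjective _ f
    exact congrArg Submodule.Quotient.mk (Subtype.ext (zero_comp (f := f.1)))
  map_add' a b := by
    refine MulOpposite.unop_injective (LinearMap.ext fun f => ?_)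
    obtain ⟨f, rfl⟩ := Submodule.Quotient.mk_surjective _ f
    exact congrArg Submodule.Quotient.mk (Subtype.ext (Preadditive.add_comp _ _ _ a b f.1))

/-- The left action of the automorphism field of `Y` on `irr(X, Y)`. -/
noncomputable instance irrModuleTarget (X Y : C) : Module (AutField Y) (Irr k X Y) :=
  Module.compHom (Irr k X Y) (Ideal.Quotient.lift (radIdeal Y) (irrPostHom k X Y) (by
    intro φ hφ
    refine LinearMap.ext fun f => ?_
    obtain ⟨f, rfl⟩ := Submodule.Quotient.mk_surjective _ f
    refine (Submodule.Quotient.mk_eq_zero _).2 ?_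
    exact Submodule.subset_span ⟨Y, f.1, φ, f.2, hφ, rfl⟩))

/-- The right action of the automorphism field of `X` on `irr(X, Y)`. -/
noncomputable instance irrModuleSource (X Y : C) : Module (AutField X)ᵐᵒᵖ (Irr k X Y) :=
  Module.compHom (Irr k X Y)
    ((RingEquiv.opOp (Module.End k (Irr k X Y))).symm.toRingHom.comp
      (RingHom.op (Ideal.Quotient.lift (radIdeal X) (irrPreHom k X Y) (by
        intro φ hφ
        refine MulOpposite.unop_injective (LinearMap.ext fun f => ?_)
        obtain ⟨f, rfl⟩ := Submodule.Quotient.mk_surjective _ f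
        refine (Submodule.Quotient.mk_eq_zero _).2 ?_
        exact Submodule.subset_span ⟨X, φ, f.1, hφ, f.2, rfl⟩))))

lemma irrModuleTarget_smul (X Y : C) (φ : End Y) (f : rad k X Y) :
    (Ideal.Quotient.mk (radIdeal Y) φ) • (Submodule.Quotient.mk f : Irr k X Y)
      = Submodule.Quotient.mk ⟨f.1 ≫ φ, IsRadical.comp_right f.2 φ⟩ := rfl

lemma irrModuleSource_smul (X Y : C) (φ : End X) (f : rad k X Y) :
    (MulOpposite.op (Ideal.Quotient.mk (radIdeal X) φ)) • (Submodule.Quotient.mk f : Irr k X Y)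
      = Submodule.Quotient.mk ⟨φ ≫ f.1, IsRadical.comp_left f.2 φ⟩ := rfl

/-- The dimension of `irr(X, Y)` over the automorphism field of the source `X`. -/
noncomputable def irrDimSource (X Y : C) : ℕ := Module.finrank (AutField X)ᵐᵒᵖ (Irr k X Y)

/-- The dimension of `irr(X, Y)` over the automorphism field of the target `Y`. -/
noncomputable def irrDimTarget (X Y : C) : ℕ := Module.finrank (AutField Y) (Irr k X Y)

/-! ### Almost split sequences -/

/-- `f : X ⟶ Y` is a source morphism for `X`: left almost split and left minimal.  Sections
and retractions are the split monomorphisms and split epimorphisms. -/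
structure IsSourceMorphism {X Y : C} (f : X ⟶ Y) : Prop where
  not_section : ¬ IsSplitMono f
  factors : ∀ {M : C} (g : X ⟶ M), ¬ IsSplitMono g → ∃ h : Y ⟶ M, f ≫ h = g
  minimal : ∀ h : Y ⟶ Y, f ≫ h = f → IsIso h

/-- `g : Y ⟶ Z` is a sink morphism for `Z`: right almost split and right minimal. -/
structure IsSinkMorphism {Y Z : C} (g : Y ⟶ Z) : Prop where
  not_retraction : ¬ IsSplitEpi g
  factors : ∀ {M : C} (f : M ⟶ Z), ¬ IsSplitEpi f → ∃ h : M ⟶ Y, h ≫ g = f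
  minimal : ∀ h : Y ⟶ Y, h ≫ g = g → IsIso h

/-- `X ⟶ Y ⟶ Z` is an almost split sequence. -/
structure IsAlmostSplit {X Y Z : C} (f : X ⟶ Y) (g : Y ⟶ Z) : Prop where
  middle_ne_zero : ¬ IsZero Y
  source : IsSourceMorphism f
  sink : IsSinkMorphism g
  comp_zero : f ≫ g = 0
  pseudoKernel : ∀ {M : C} (u : M ⟶ Y), u ≫ g = 0 → ∃ w : M ⟶ X, w ≫ f = u
  pseudoCokernel : ∀ {M : C} (v : Y ⟶ M), f ≫ v = 0 → ∃ w : Z ⟶ M, g ≫ w = v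

/-- There is an almost split sequence starting in `X` and ending in `Z`. -/
def IsTranslate (X Z : C) : Prop :=
  ∃ (Y : C) (f : X ⟶ Y) (g : Y ⟶ Z), IsAlmostSplit f g

end Basic

/-! ### Valued translation quivers -/

/-- A valued translation quiver on a vertex set `W`, with at most one valued arrow between two
vertices.  There is an arrow `x → y` iff `0 < valTarget x y`, and then its valuation is
`(valTarget x y, valSource x y)`.  An arrow with symmetric valuation `(d, d)` stands for `d`
unvalued arrows.  The (partial) translation is given by its graph: `tau x z` means `x = τ z`. -/
structure ValuedTransQuiver (W : Type*) where
  valSource : W → W → ℕ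
  valTarget : W → W → ℕ
  tau : W → W → Prop

namespace ValuedTransQuiver

variable {W W₁ W₂ : Type*}

/-- The full translation subquiver generated by a set of vertices. -/
def restrict (T : ValuedTransQuiver W) (S : Set W) : ValuedTransQuiver S where
  valSource x y := T.valSource x y
  valTarget x y := T.valTarget x y
  tau x z := T.tau x z

/-- There is an arrow `x → y`. -/
def HasArrow (T : ValuedTransQuiver W) (x y : W) : Prop := 0 < T.valTarget x y

/-- `S` is (the vertex set of) a connected component. -/
def IsComponent (T : ValuedTransQuiver W) (S : Set W) : Prop :=
  ∃ x, S = {y | Relation.EqvGen T.HasArrow x y}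

/-- Isomorphisms of valued translation quivers. -/
structure Iso (T₁ : ValuedTransQuiver W₁) (T₂ : ValuedTransQuiver W₂) extends W₁ ≃ W₂ where
  valSource_eq : ∀ x y, T₂.valSource (toFun x) (toFun y) = T₁.valSource x y
  valTarget_eq : ∀ x y, T₂.valTarget (toFun x) (toFun y) = T₁.valTarget x y
  tau_iff : ∀ x y, T₂.tau (toFun x) (toFun y) ↔ T₁.tau x y

/-- The stable translation quiver `ℤΔ` of the quiver `Δ` with `a x y` arrows from `x` to `y`:
each arrow `x → y` of `Δ` gives arrows `(n, x) → (n, y)` and `(n, y) → (n + 1, x)`,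
and `τ (n, x) = (n - 1, x)`. -/
def repetition (a : W → W → ℕ) : ValuedTransQuiver (ℤ × W) where
  valSource p q := if q.1 = p.1 then a p.2 q.2 else if q.1 = p.1 + 1 then a q.2 p.2 else 0
  valTarget p q := if q.1 = p.1 then a p.2 q.2 else if q.1 = p.1 + 1 then a q.2 p.2 else 0
  tau p q := p.1 = q.1 - 1 ∧ p.2 = q.2

/-- The quiver `0 → 1 → 2 → ⋯`, that is `𝔸_∞⁺`. -/
def AInfPlus (i j : ℕ) : ℕ := if j = i + 1 then 1 else 0

/-- The quiver `⋯ → 2 → 1 → 0`, that is `𝔸_∞⁻`. -/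
def AInfMinus (i j : ℕ) : ℕ := if i = j + 1 then 1 else 0

/-- `ℤ𝔸_∞`; up to isomorphism it does not depend on the orientation of `𝔸_∞`. -/
def ZAInf : ValuedTransQuiver (ℤ × ℕ) := repetition AInfPlus

/-- `ℕ𝔸_∞⁺`. -/
def NAInfPlus : ValuedTransQuiver {p : ℤ × ℕ | 0 ≤ p.1} :=
  (repetition AInfPlus).restrict {p : ℤ × ℕ | 0 ≤ p.1}

/-- `ℕ⁻𝔸_∞⁻`. -/
def NegNAInfMinus : ValuedTransQuiver {p : ℤ × ℕ | p.1 ≤ 0} :=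
  (repetition AInfMinus).restrict {p : ℤ × ℕ | p.1 ≤ 0}

/-- The wing of rank `n`: the triangle in `ℤ𝔸_∞` with bottom vertices `(0, 0), …, (n - 1, 0)`
and top vertex `(0, n - 1)`.  The second coordinate of a vertex is its height. -/
def wing (n : ℕ) : ValuedTransQuiver {p : ℤ × ℕ | 0 ≤ p.1 ∧ p.1 + p.2 < n} :=
  (repetition AInfPlus).restrict {p : ℤ × ℕ | 0 ≤ p.1 ∧ p.1 + p.2 < n}

/-- The (nonempty) valued translation quiver `T` is a wing. -/
def IsWing (T : ValuedTransQuiver W) : Prop := ∃ n : ℕ, 1 ≤ n ∧ Nonempty (T.Iso (wing n))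

/-- `T` is of shape `ℤ𝔸_∞`, `ℕ𝔸_∞⁺` or `ℕ⁻𝔸_∞⁻`. -/
def IsAInfShape (T : ValuedTransQuiver W) : Prop :=
  Nonempty (T.Iso ZAInf) ∨ Nonempty (T.Iso NAInfPlus) ∨ Nonempty (T.Iso NegNAInfMinus)

/-- The quasi-simple vertices: those at the bottom of a wing; those with at most one immediate
predecessor and at most one immediate successor for the shapes `ℤ𝔸_∞`, `ℕ𝔸_∞⁺`, `ℕ⁻𝔸_∞⁻`. -/
def IsQuasiSimple (T : ValuedTransQuiver W) (x : W) : Prop :=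
  (∃ (n : ℕ) (e : T.Iso (wing n)), (e.toFun x).1.2 = 0) ∨
  (T.IsAInfShape ∧ {y | T.HasArrow y x}.Subsingleton ∧ {y | T.HasArrow x y}.Subsingleton)

/-! ### The mesh category -/

/-- The vertices of a translation quiver all of whose valuations are symmetric, as the vertices
of the associated (non-valued) quiver. -/
def Vertex (_T : ValuedTransQuiver W) : Type _ := W

instance (T : ValuedTransQuiver W) : Quiver.{0} T.Vertex where
  Hom x y := Fin (T.valTarget x y)

variable (k : Type w) [Field k] (T : ValuedTransQuiver W)

/-- The path category over `k`: morphisms are formal linear combinations of paths. -/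
abbrev PathCat : Type _ := Free k (Paths T.Vertex)

/-- A vertex as an object of the path category. -/
abbrev pathObj (x : W) : PathCat k T := Free.of k ((Paths.of T.Vertex).obj x)

variable {T} in
/-- An arrow as a morphism of the path category. -/
noncomputable def arrow {x y : W} (i : Fin (T.valTarget x y)) :
    pathObj k T x ⟶ pathObj k T y :=
  (Free.embedding k (Paths T.Vertex)).map
    ((Paths.of T.Vertex).map (show @Quiver.Hom T.Vertex _ x y from i))

/-- The mesh element `∑ β_i α_i`, where `α_i : x ⟶ y_i` runs through the arrows starting in `x`
and `β_i : y_i ⟶ z` through the arrows ending in `z`, for `x = τ z`.  There are as many arrows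
`x ⟶ y` as `y ⟶ z`, and these are matched according to their numbering. -/
noncomputable def meshElement (x z : W) : pathObj k T x ⟶ pathObj k T z :=
  ∑ᶠ y : W, ∑ i : Fin (T.valTarget x y), ∑ j : Fin (T.valTarget y z),
    if i.val = j.val then arrow k i ≫ arrow k j else 0

/-- The mesh ideal: the ideal of the path category generated by the mesh elements. -/
noncomputable def meshIdeal (a b : PathCat k T) : Submodule k (a ⟶ b) :=
  Submodule.span k {h | ∃ (x z : W) (p : a ⟶ pathObj k T x) (q : pathObj k T z ⟶ b),
    T.tau x z ∧ h = p ≫ meshElement k T x z ≫ q}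

/-- Congruence modulo the mesh ideal. -/
def meshRel : HomRel (PathCat k T) := fun a b f g => f - g ∈ meshIdeal k T a b

instance : Congruence (meshRel k T) where
  equivalence := by
    intro a b
    refine ⟨fun f => ?_, fun {f g} h => ?_, fun {f g l} h₁ h₂ => ?_⟩
    · simp [meshRel]
    · have := neg_mem (show f - g ∈ meshIdeal k T a b from h)
      simpa [meshRel] using this
    · have := add_mem (show f - g ∈ meshIdeal k T a b from h₁)
        (show g - l ∈ meshIdeal k T a b from h₂)
      simpa [meshRel] using this
  comp_left := by
    intro a b c f g₁ g₂ h
    have : meshIdeal k T b c ≤ (meshIdeal k T a c).comap (Linear.leftComp k c f) := by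
      refine Submodule.span_le.2 ?_
      rintro _ ⟨x, z, p, q, hxz, rfl⟩
      exact Submodule.subset_span ⟨x, z, f ≫ p, q, hxz, by
        simp only [Linear.leftComp_apply, Category.assoc]⟩
    have h' := this h
    simpa [meshRel, Preadditive.comp_sub] using h'
  comp_right := by
    intro a b c f₁ f₂ g h
    have : meshIdeal k T a b ≤ (meshIdeal k T a c).comap (Linear.rightComp k a g) := by
      refine Submodule.span_le.2 ?_
      rintro _ ⟨x, z, p, q, hxz, rfl⟩
      exact Submodule.subset_span ⟨x, z, p, q ≫ g, hxz, by
        simp only [Linear.rightComp_apply, Category.assoc]⟩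
    have h' := this h
    simpa [meshRel, Preadditive.sub_comp] using h'

/-- The mesh category: the quotient of the path category by the mesh ideal. -/
abbrev MeshCat : Type _ := Quotient (meshRel k T)

lemma meshRel_add ⦃a b : PathCat k T⦄ (f₁ f₂ g₁ g₂ : a ⟶ b)
    (h : meshRel k T f₁ f₂) (h' : meshRel k T g₁ g₂) : meshRel k T (f₁ + g₁) (f₂ + g₂) := by
  have := add_mem (show f₁ - f₂ ∈ meshIdeal k T a b from h)
    (show g₁ - g₂ ∈ meshIdeal k T a b from h')
  rwa [sub_add_sub_comm] at this

lemma meshRel_smul (c : k) ⦃a b : PathCat k T⦄ (f₁ f₂ : a ⟶ b)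
    (h : meshRel k T f₁ f₂) : meshRel k T (c • f₁) (c • f₂) := by
  have := Submodule.smul_mem _ c (show f₁ - f₂ ∈ meshIdeal k T a b from h)
  rwa [smul_sub] at this

noncomputable instance : Preadditive (MeshCat k T) :=
  Quotient.preadditive (meshRel k T) (meshRel_add k T)

instance : (Quotient.functor (meshRel k T)).Additive :=
  Quotient.functor_additive (meshRel k T) (meshRel_add k T)

noncomputable instance : Linear k (MeshCat k T) :=
  Quotient.linear k (meshRel k T) (meshRel_smul k T)

end ValuedTransQuiver

/-! ### The Auslander-Reiten quiver and standard components -/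

section ARQuiver

variable (k : Type w) [Field k] {C : Type u} [Category.{v} C] [Preadditive C] [Linear k C]

/-- Indecomposable objects of an additive category. -/
def IsIndecomposable [HasFiniteBiproducts C] (X : C) : Prop :=
  have : HasBinaryBiproducts C := hasBinaryBiproducts_of_finite_biproducts C
  Indecomposable X

/-- `V` is a complete set of representatives of the isomorphism classes of the indecomposable
objects. -/
structure IsCompleteSetOfIndecomposables [HasFiniteBiproducts C] (V : Set C) : Prop where
  indecomposable : ∀ X ∈ V, IsIndecomposable X
  eq_of_iso : ∀ X ∈ V, ∀ Y ∈ V, Nonempty (X ≅ Y) → X = Y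
  exists_iso : ∀ X : C, IsIndecomposable X → ∃ Y ∈ V, Nonempty (X ≅ Y)

/-- The Auslander-Reiten quiver, with vertex set `V`. -/
noncomputable def arQuiver (V : Set C) : ValuedTransQuiver V where
  valSource X Y := irrDimSource k X.1 Y.1
  valTarget X Y := irrDimTarget k X.1 Y.1
  tau X Z := IsTranslate X.1 Z.1

variable {V : Set C}

/-- The full subcategory of `C` generated by the objects in `S`. -/
abbrev FullSubcat (S : Set V) : Type _ := InducedCategory C (fun X : S => X.1.1)

/-- The component with vertex set `S` is standard: all its objects have trivial automorphism
field, and there is a `k`-linear equivalence from its mesh category to the full subcategory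
generated by its objects which acts identically on the objects. -/
def IsStandard (S : Set V) : Prop :=
  (∀ X : S, HasTrivialAutField k X.1.1) ∧
  ∃ F : ((arQuiver k V).restrict S).MeshCat k ⥤ FullSubcat S,
    F.Additive ∧ F.Linear k ∧ F.IsEquivalence ∧ ∀ X : S, F.obj ⟨X⟩ = X

/-- The quasi-simple objects of the component with vertex set `S` are pairwise orthogonal
bricks. -/
def QuasiSimplesAreOrthogonalBricks (S : Set V) : Prop :=
  (∀ X : S, ((arQuiver k V).restrict S).IsQuasiSimple X → IsBrick k X.1.1) ∧
  ∀ X Y : S, ((arQuiver k V).restrict S).IsQuasiSimple X →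
    ((arQuiver k V).restrict S).IsQuasiSimple Y → X ≠ Y → Orthogonal X.1.1 Y.1.1

end ARQuiver

end AR

/-! All four shapes have the same coordinates: the vertices are the intervals [a,b] with endpoints
in a convex set J of integers, the arrows are [a,b] → [a,b+1] ("right") and [a,b] → [a+1,b]
("down"), the translate of [a+1,b+1] is [a,b], and the quasi-simples are the [a,a]. The guiding
picture is a uniserial object with composition factors a, …, b, socle a and top b. Accordingly a
nonzero morphism [a,b] → [c,d] should exist exactly when a ≤ c ≤ b ≤ d, and be unique up to scalars.

In the mesh category, every path can be rewritten, up to sign, to go first down and then right, and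
it vanishes once it leaves this range (`IsIntervalShape.meshHom`). Hence distinct quasi-simples have
no morphisms between them and each has only scalar endomorphisms. A full functor carries this over
to a standard component.

Conversely, let the quasi-simples be orthogonal bricks. Since all valuations are (1,1), triviality
of the automorphism field spreads from [a,a] to all [a,b]. Irreducible maps out of an object then
assemble to a source morphism, and the almost split sequences become squares that are both weak
pullbacks and weak pushouts (`exists_mesh`, `exists_coherent`). Diagram chases in these squares,
starting from the hypothesis on quasi-simples, give the expected morphism spaces: a map [a,b] →
[c,d] with a ≠ c factors through the down arrow out of [a,b], and one with b ≠ d through the right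
arrow into [c,d]. Vanishing, dimension at most one and nonvanishing of composites follow by
induction.

Finally the arrows are rescaled so that the squares anticommute (`HasMeshHoms.exists_arrows`). The
resulting functor from the mesh category is full because the targets are at most one-dimensional and
are reached by nonzero composites. It is faithful because the mesh morphism spaces are at most
one-dimensional too (`HasMeshHoms.exists_equivalence`). -/

namespace AR

/-! ### Radical and irreducible morphisms, and almost split sequences as squares -/

section Radical

variable (k : Type w) [Field k] {C : Type u} [Category.{v} C] [Preadditive C] [Linear k C]

/-- Irreducible morphisms: radical morphisms outside the square of the radical. -/
def IsIrred {X Y : C} (f : X ⟶ Y) : Prop := IsRadical f ∧ f ∉ radSq k X Y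

variable {k}

lemma IsRadical.neg {X Y : C} {f : X ⟶ Y} (h : IsRadical f) : IsRadical (-f) := by
  have : -f = f ≫ (-𝟙 Y) := by simp
  rw [this]
  exact h.comp_right _

lemma IsRadical.sum {ι : Type*} {X Y : C} (s : Finset ι) (f : ι → (X ⟶ Y))
    (h : ∀ i ∈ s, IsRadical (f i)) : IsRadical (∑ i ∈ s, f i) := by
  classical
  induction s using Finset.induction_on with
  | empty => simpa using isRadical_zero X Y
  | insert a s ha ih =>
    rw [Finset.sum_insert ha]
    exact (h a (by simp)).add (ih fun i hi => h i (by simp [hi]))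

lemma id_ne_zero_of_isLocalRing (X : C) [IsLocalRing (End X)] : 𝟙 X ≠ 0 :=
  one_ne_zero (α := End X)

lemma not_isZero_of_isLocalRing (X : C) [IsLocalRing (End X)] : ¬ IsZero X := fun h =>
  id_ne_zero_of_isLocalRing X (h.eq_of_src _ _)

lemma exists_comp_eq_id_of_not_isRadical {X Y : C} [IsLocalRing (End X)] {f : X ⟶ Y}
    (h : ¬ IsRadical f) : ∃ r : Y ⟶ X, f ≫ r = 𝟙 X := by
  simp only [IsRadical, not_forall] at h
  obtain ⟨g, hg⟩ := h
  have h2 : ¬ IsUnit (1 - End.of (f ≫ g)) := fun h3 => hg ((isUnit_iff_isIso _).1 h3)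
  have h3 := (IsLocalRing.isUnit_or_isUnit_of_add_one
    (add_sub_cancel (End.of (f ≫ g)) 1)).resolve_right h2
  have : IsIso (f ≫ g) := (isUnit_iff_isIso _).1 h3
  exact ⟨g ≫ inv (f ≫ g), by rw [← Category.assoc, IsIso.hom_inv_id]⟩

lemma exists_id_eq_comp_of_not_isRadical {X Y : C} [IsLocalRing (End Y)] {f : X ⟶ Y}
    (h : ¬ IsRadical f) : ∃ r : Y ⟶ X, r ≫ f = 𝟙 Y := by
  simp only [IsRadical, not_forall] at h
  obtain ⟨g, hg⟩ := h
  have h2 : ¬ IsUnit (1 - End.of (g ≫ f)) := fun h3 =>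
    hg (isIso_one_sub_swap g f ((isUnit_iff_isIso _).1 h3))
  have h3 := (IsLocalRing.isUnit_or_isUnit_of_add_one
    (add_sub_cancel (End.of (g ≫ f)) 1)).resolve_right h2
  have : IsIso (g ≫ f) := (isUnit_iff_isIso _).1 h3
  exact ⟨inv (g ≫ f) ≫ g, by rw [Category.assoc, IsIso.inv_hom_id]⟩

lemma not_isRadical_of_comp_eq_id {X Y : C} {f : X ⟶ Y} {r : Y ⟶ X} (h : f ≫ r = 𝟙 X)
    (hX : 𝟙 X ≠ 0) : ¬ IsRadical f := by
  intro hf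
  have := hf r
  rw [h, sub_self] at this
  exact hX ((isZero_of_isIso_zero X X).eq_of_src _ _)
where
  isZero_of_isIso_zero (X Y : C) [IsIso (0 : X ⟶ Y)] : IsZero X :=
    (IsZero.iff_id_eq_zero X).2 (by rw [← IsIso.hom_inv_id (0 : X ⟶ Y), zero_comp])

lemma not_isSplitMono_of_isRadical {X Y : C} {f : X ⟶ Y} (hf : IsRadical f) (hX : 𝟙 X ≠ 0) :
    ¬ IsSplitMono f := fun _ =>
  not_isRadical_of_comp_eq_id (IsSplitMono.id f) hX hf

lemma not_isSplitEpi_of_isRadical {X Y : C} {f : X ⟶ Y} (hf : IsRadical f) (hY : 𝟙 Y ≠ 0) :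
    ¬ IsSplitEpi f := fun _ => by
  have h1 : IsRadical (section_ f ≫ f) := hf.comp_left _
  rw [IsSplitEpi.id] at h1
  exact not_isRadical_of_comp_eq_id (Category.comp_id (𝟙 Y)) hY h1

lemma IsRadical.eq_zero_of_idem {X : C} {e : X ⟶ X} (he : IsRadical e) (h : e ≫ e = e) :
    e = 0 := by
  have := he (𝟙 X)
  rw [Category.comp_id] at this
  have h2 : (𝟙 X - e) ≫ e = 0 := by simp [h]
  rw [← cancel_epi (𝟙 X - e), h2, comp_zero]

lemma isRadical_of_not_iso {X Y : C} [IsLocalRing (End X)] [IsLocalRing (End Y)]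
    (h : ¬ Nonempty (X ≅ Y)) (f : X ⟶ Y) : IsRadical f := by
  by_contra hf
  obtain ⟨r, hr⟩ := exists_comp_eq_id_of_not_isRadical hf
  obtain ⟨s, hs⟩ := exists_id_eq_comp_of_not_isRadical hf
  have : s = r := by rw [← Category.comp_id s, ← hr, ← Category.assoc, hs, Category.id_comp]
  exact h ⟨⟨f, r, hr, this ▸ hs⟩⟩

lemma IsIrred.neg {X Y : C} {f : X ⟶ Y} (h : IsIrred k f) : IsIrred k (-f) :=
  ⟨h.1.neg, fun h' => h.2 (by simpa using neg_mem h')⟩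

lemma IsIrred.ne_zero {X Y : C} {f : X ⟶ Y} (h : IsIrred k f) : f ≠ 0 := by
  rintro rfl
  exact h.2 (zero_mem _)

lemma IsSourceMorphism.isRadical {X Y : C} [IsLocalRing (End X)] {f : X ⟶ Y}
    (h : IsSourceMorphism f) : IsRadical f := by
  by_contra hf
  obtain ⟨r, hr⟩ := exists_comp_eq_id_of_not_isRadical hf
  exact h.not_section (IsSplitMono.mk' ⟨r, hr⟩)

lemma IsSinkMorphism.isRadical {Y Z : C} [IsLocalRing (End Z)] {g : Y ⟶ Z}
    (h : IsSinkMorphism g) : IsRadical g := by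
  by_contra hg
  obtain ⟨r, hr⟩ := exists_id_eq_comp_of_not_isRadical hg
  exact h.not_retraction (IsSplitEpi.mk' ⟨r, hr⟩)

/-- The first factor of each product in rad² factors through `f`, so `f ≫ φ = f ≫ ρ` with `ρ`
radical. If `φ - ρ` were not radical, it would be a split epimorphism killed by `f`. The
complementary endomorphism of `Y` fixes `f`, hence is invertible by minimality, yet it annihilates
`φ - ρ`. -/
lemma IsSourceMorphism.isRadical_of_comp_mem_radSq {X Y M : C} [IsLocalRing (End X)]
    [IsLocalRing (End M)] {f : X ⟶ Y} (h : IsSourceMorphism f) {φ : Y ⟶ M}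
    (hφ : f ≫ φ ∈ radSq k X M) : IsRadical φ := by
  have key : ∃ ρ : Y ⟶ M, IsRadical ρ ∧ f ≫ ρ = f ≫ φ := by
    refine Submodule.span_induction (p := fun t _ => ∃ ρ : Y ⟶ M, IsRadical ρ ∧ f ≫ ρ = t)
      ?_ ?_ ?_ ?_ hφ
    · rintro _ ⟨W, a, b, ha, hb, rfl⟩
      obtain ⟨a', rfl⟩ := h.factors a
        (not_isSplitMono_of_isRadical ha (id_ne_zero_of_isLocalRing X))
      exact ⟨a' ≫ b, hb.comp_left a', by simp⟩
    · exact ⟨0, isRadical_zero _ _, by simp⟩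
    · rintro _ _ _ _ ⟨a, ha, rfl⟩ ⟨b, hb, rfl⟩
      exact ⟨a + b, ha.add hb, by simp⟩
    · rintro c _ _ ⟨a, ha, rfl⟩
      exact ⟨c • a, ha.smul k c, by simp⟩
  obtain ⟨ρ, hρ, hfρ⟩ := key
  suffices hψ : IsRadical (φ - ρ) by simpa using hψ.add hρ
  by_contra hψ
  obtain ⟨s, hs⟩ := exists_id_eq_comp_of_not_isRadical hψ
  have h0 : f ≫ (φ - ρ) = 0 := by simp [hfρ]
  have hi : IsIso (𝟙 Y - (φ - ρ) ≫ s) := h.minimal _ (by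
    rw [Preadditive.comp_sub, Category.comp_id, ← Category.assoc, h0, zero_comp, sub_zero])
  have h1 : (𝟙 Y - (φ - ρ) ≫ s) ≫ (φ - ρ) = 0 := by
    rw [Preadditive.sub_comp, Category.id_comp, Category.assoc, hs, Category.comp_id, sub_self]
  have h2 : φ - ρ = 0 := by
    rw [← cancel_epi (𝟙 Y - (φ - ρ) ≫ s), h1, comp_zero]
  rw [h2, comp_zero] at hs
  exact id_ne_zero_of_isLocalRing M hs.symm

lemma IsSinkMorphism.isRadical_of_comp_mem_radSq {Y Z M : C} [IsLocalRing (End Z)]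
    [IsLocalRing (End M)] {g : Y ⟶ Z} (h : IsSinkMorphism g) {φ : M ⟶ Y}
    (hφ : φ ≫ g ∈ radSq k M Z) : IsRadical φ := by
  have key : ∃ ρ : M ⟶ Y, IsRadical ρ ∧ ρ ≫ g = φ ≫ g := by
    refine Submodule.span_induction (p := fun t _ => ∃ ρ : M ⟶ Y, IsRadical ρ ∧ ρ ≫ g = t)
      ?_ ?_ ?_ ?_ hφ
    · rintro _ ⟨W, a, b, ha, hb, rfl⟩
      obtain ⟨b', rfl⟩ := h.factors b
        (not_isSplitEpi_of_isRadical hb (id_ne_zero_of_isLocalRing Z))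
      exact ⟨a ≫ b', ha.comp_right b', by simp⟩
    · exact ⟨0, isRadical_zero _ _, by simp⟩
    · rintro _ _ _ _ ⟨a, ha, rfl⟩ ⟨b, hb, rfl⟩
      exact ⟨a + b, ha.add hb, by simp⟩
    · rintro c _ _ ⟨a, ha, rfl⟩
      exact ⟨c • a, ha.smul k c, by simp⟩
  obtain ⟨ρ, hρ, hfρ⟩ := key
  suffices hψ : IsRadical (φ - ρ) by simpa using hψ.add hρ
  by_contra hψ
  obtain ⟨s, hs⟩ := exists_comp_eq_id_of_not_isRadical hψ
  have h0 : (φ - ρ) ≫ g = 0 := by simp [hfρ]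
  have hi : IsIso (𝟙 Y - s ≫ (φ - ρ)) := h.minimal _ (by
    rw [Preadditive.sub_comp, Category.id_comp, Category.assoc, h0, comp_zero, sub_zero])
  have h1 : (φ - ρ) ≫ (𝟙 Y - s ≫ (φ - ρ)) = 0 := by
    rw [Preadditive.comp_sub, Category.comp_id, ← Category.assoc, hs, Category.id_comp, sub_self]
  have h2 : φ - ρ = 0 := by
    rw [← cancel_mono (𝟙 Y - s ≫ (φ - ρ)), h1, zero_comp]
  rw [h2, zero_comp] at hs
  exact id_ne_zero_of_isLocalRing M hs.symm

lemma IsKrullSchmidt.isRadical_of_forall_comp [HasFiniteBiproducts C] (hKS : IsKrullSchmidt C)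
    {X Y : C} (f : X ⟶ Y)
    (h : ∀ (M : C) (_ : IsLocalRing (End M)) (p : Y ⟶ M), IsRadical (f ≫ p)) :
    IsRadical f := by
  by_cases hY : IsZero Y
  · rw [hY.eq_of_tgt f 0]
    exact isRadical_zero _ _
  obtain ⟨n, M, hM, ⟨θ⟩⟩ := hKS Y hY
  have : f = ∑ i, (f ≫ θ.hom ≫ biproduct.π M i) ≫ biproduct.ι M i ≫ θ.inv := by
    have h1 : f = f ≫ θ.hom ≫ 𝟙 _ ≫ θ.inv := by simp
    rw [← biproduct.total, Preadditive.sum_comp, Preadditive.comp_sum, Preadditive.comp_sum] at h1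
    simpa using h1
  rw [this]
  exact IsRadical.sum _ _ fun i _ => (h _ (hM i) _).comp_right _

/-- A commutative square that is both a weak pullback and a weak pushout. -/
structure IsWeakBicartesian {X Y₁ Y₂ Z : C} (f₁ : X ⟶ Y₁) (f₂ : X ⟶ Y₂) (g₁ : Y₁ ⟶ Z)
    (g₂ : Y₂ ⟶ Z) : Prop where
  w : f₁ ≫ g₁ = f₂ ≫ g₂
  exists_lift : ∀ {M : C} (p : M ⟶ Y₁) (q : M ⟶ Y₂), p ≫ g₁ = q ≫ g₂ →
    ∃ t : M ⟶ X, t ≫ f₁ = p ∧ t ≫ f₂ = q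
  exists_desc : ∀ {M : C} (p : Y₁ ⟶ M) (q : Y₂ ⟶ M), f₁ ≫ p = f₂ ≫ q →
    ∃ t : Z ⟶ M, g₁ ≫ t = p ∧ g₂ ≫ t = q

lemma isIso_of_one_add_radical {X : C} {f : X ⟶ X} (h : IsRadical (f - 𝟙 X)) : IsIso f := by
  have := h.neg (𝟙 X)
  simpa using this

/-- The pseudo-kernel and pseudo-cokernel properties, read off componentwise. The sign turns `f ≫ g
= 0` into commutativity of the square. -/
lemma IsAlmostSplit.isWeakBicartesian [HasBinaryBiproducts C] {X Y₁ Y₂ Y Z : C} {f : X ⟶ Y}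
    {g : Y ⟶ Z} (h : IsAlmostSplit f g) (θ : Y ≅ Y₁ ⊞ Y₂) :
    IsWeakBicartesian (f ≫ θ.hom ≫ biprod.fst) (f ≫ θ.hom ≫ biprod.snd)
      (biprod.inl ≫ θ.inv ≫ g) (-(biprod.inr ≫ θ.inv ≫ g)) := by
  have tot : ∀ {W : C} (a : W ⟶ Y), a ≫ θ.hom ≫ biprod.fst ≫ biprod.inl ≫ θ.inv +
      a ≫ θ.hom ≫ biprod.snd ≫ biprod.inr ≫ θ.inv = a := by
    intro W a
    have : a = a ≫ θ.hom ≫ 𝟙 _ ≫ θ.inv := by simp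
    rw [← biprod.total, Preadditive.add_comp, Preadditive.comp_add, Preadditive.comp_add] at this
    simpa using this.symm
  refine ⟨?_, ?_, ?_⟩
  · have h1 := congrArg (fun t => t ≫ g) (tot f)
    simp only [Preadditive.add_comp, Category.assoc, h.comp_zero] at h1
    simp only [Category.assoc, Preadditive.comp_neg]
    exact eq_neg_of_add_eq_zero_left h1
  · intro M p q hpq
    obtain ⟨t, ht⟩ := h.pseudoKernel (biprod.lift p q ≫ θ.inv) (by
      rw [biprod.lift_eq]
      simp only [Preadditive.add_comp, Category.assoc, hpq]
      simp)
    refine ⟨t, ?_, ?_⟩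
    · rw [← Category.assoc, ht]; simp
    · rw [← Category.assoc, ht]; simp
  · intro M p q hpq
    obtain ⟨t, ht⟩ := h.pseudoCokernel (θ.hom ≫ biprod.desc p (-q)) (by
      rw [biprod.desc_eq]
      simp only [Category.assoc] at hpq
      simp [hpq])
    refine ⟨t, ?_, ?_⟩
    · simp [ht]
    · simp [ht]

/-- Irreducible morphisms out of `X` that exhaust `irr(X, -)` assemble to a source morphism,
hence are completed to a mesh by the almost split sequence starting in `X`. -/
theorem exists_mesh [HasFiniteBiproducts C] (hKS : IsKrullSchmidt C) {X Y₁ Y₂ Z : C}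
    (hX : IsLocalRing (End X)) (hY₁ : IsLocalRing (End Y₁)) (hZ : IsLocalRing (End Z))
    (hY₂ : IsZero Y₂ ∨ IsLocalRing (End Y₂)) (hne : ¬ Nonempty (Y₁ ≅ Y₂))
    (hXZ : IsTranslate X Z) {u₁ : X ⟶ Y₁} {v₁ : X ⟶ Y₂}
    (hu : IsIrred k u₁) (hv : IsZero Y₂ ∨ IsIrred k v₁)
    (gen₁ : ∀ f : X ⟶ Y₁, IsRadical f → ∃ c : k, f - c • u₁ ∈ radSq k X Y₁)
    (gen₂ : ∀ f : X ⟶ Y₂, IsRadical f → ∃ c : k, f - c • v₁ ∈ radSq k X Y₂)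
    (compl : ∀ (M : C) (_ : IsLocalRing (End M)) (f : X ⟶ M), IsIrred k f →
      Nonempty (M ≅ Y₁) ∨ Nonempty (M ≅ Y₂)) :
    ∃ (v₂ : Y₁ ⟶ Z) (u₂ : Y₂ ⟶ Z), IsIrred k v₂ ∧ (IsZero Y₂ ∨ IsIrred k u₂) ∧
      IsWeakBicartesian u₁ v₁ v₂ u₂ := by
  have : HasBinaryBiproducts C := hasBinaryBiproducts_of_finite_biproducts C
  obtain ⟨Y, f, g, hfg⟩ := hXZ
  have hX1 := id_ne_zero_of_isLocalRing X
  have hf := hfg.source.isRadical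
  have hg := hfg.sink.isRadical
  have hv1 : IsRadical v₁ := by
    rcases hv with h | h
    · rw [h.eq_of_tgt v₁ 0]; exact isRadical_zero _ _
    · exact h.1
  obtain ⟨h₁, e₁⟩ := hfg.source.factors u₁ (not_isSplitMono_of_isRadical hu.1 hX1)
  obtain ⟨h₂, e₂⟩ := hfg.source.factors v₁ (not_isSplitMono_of_isRadical hv1 hX1)
  have nonrad : ∀ {W : C} {a : X ⟶ W} {b : Y ⟶ W}, IsIrred k a → f ≫ b = a → ¬ IsRadical b := by
    rintro W a b ha rfl hb
    exact ha.2 (Submodule.subset_span ⟨Y, f, b, hf, hb, rfl⟩)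
  obtain ⟨s₁, hs₁⟩ := exists_id_eq_comp_of_not_isRadical (nonrad hu e₁)
  obtain ⟨s₂, hs₂⟩ : ∃ s₂ : Y₂ ⟶ Y, s₂ ≫ h₂ = 𝟙 Y₂ := by
    rcases hv with h | h
    · exact ⟨0, h.eq_of_src _ _⟩
    · have : IsLocalRing (End Y₂) := hY₂.resolve_left fun hz =>
        h.ne_zero (hz.eq_of_tgt _ _)
      exact exists_id_eq_comp_of_not_isRadical (nonrad h e₂)
  have r12 : ∀ a : Y₁ ⟶ Y₂, IsRadical a := fun a => by
    rcases hY₂ with h | h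
    · rw [h.eq_of_tgt a 0]; exact isRadical_zero _ _
    · exact isRadical_of_not_iso hne a
  have r21 : ∀ a : Y₂ ⟶ Y₁, IsRadical a := fun a => by
    rcases hY₂ with h | h
    · rw [h.eq_of_src a 0]; exact isRadical_zero _ _
    · exact isRadical_of_not_iso (fun ⟨i⟩ => hne ⟨i.symm⟩) a
  let h := biprod.lift h₁ h₂
  -- The matrix of this endomorphism of `Y₁ ⊞ Y₂` is the identity plus off-diagonal entries, which
  -- are radical because `Y₁` and `Y₂` are not isomorphic. Correcting by its inverse splits `h`, and
  -- `e` is the idempotent projecting onto the complement.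
  have hsh : IsIso (biprod.desc s₁ s₂ ≫ h) := by
    apply isIso_of_one_add_radical
    have : biprod.desc s₁ s₂ ≫ h - 𝟙 _ =
        biprod.fst ≫ (s₁ ≫ h₂) ≫ biprod.inr + biprod.snd ≫ (s₂ ≫ h₁) ≫ biprod.inl := by
      ext <;> simp [h, hs₁, hs₂]
    rw [this]
    exact (((r12 _).comp_right _).comp_left _).add (((r21 _).comp_right _).comp_left _)
  let s := inv (biprod.desc s₁ s₂ ≫ h) ≫ biprod.desc s₁ s₂
  have hs : s ≫ h = 𝟙 _ := by
    simp only [s, Category.assoc]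
    exact IsIso.inv_hom_id _
  let e := 𝟙 Y - h ≫ s
  have heh : e ≫ h = 0 := by simp [e, hs]
  have hee : e ≫ e = e := by
    have : e ≫ h ≫ s = 0 := by rw [← Category.assoc, heh, zero_comp]
    calc e ≫ e = e - e ≫ h ≫ s := by simp only [e, Preadditive.comp_sub, Category.comp_id]
      _ = e := by rw [this, sub_zero]
  have heh₁ : e ≫ h₁ = 0 := by simpa [h] using congrArg (fun t => t ≫ biprod.fst) heh
  have heh₂ : e ≫ h₂ = 0 := by simpa [h] using congrArg (fun t => t ≫ biprod.snd) heh
  -- A summand of `Y` beyond `Y₁` and `Y₂` would give another irreducible map `f ≫ e ≫ p`. By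
  -- `compl` its target is `Y₁` or `Y₂`, and modulo rad² the map is a multiple of `u₁` or `v₁`. As
  -- `e` kills `h₁` and `h₂`, this makes `e ≫ p` radical after all. Being radical and idempotent,
  -- `e` is then zero.
  have he : IsRadical e := by
    refine hKS.isRadical_of_forall_comp e fun M hM p => ?_
    by_contra hp
    have hirr : IsIrred k (f ≫ e ≫ p) :=
      ⟨hf.comp_right _, fun h' => hp (hfg.source.isRadical_of_comp_mem_radSq h')⟩
    have main : ∀ (W : C) (_ : IsLocalRing (End W)) (t : X ⟶ W) (b : Y ⟶ W), f ≫ b = t →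
        e ≫ b = 0 → (∀ f : X ⟶ W, IsRadical f → ∃ c : k, f - c • t ∈ radSq k X W) →
        ¬ Nonempty (M ≅ W) := by
      rintro W hW t b rfl heb gen ⟨θ⟩
      obtain ⟨c, hc⟩ := gen (f ≫ e ≫ p ≫ θ.hom) (hf.comp_right _)
      have hc' : f ≫ (e ≫ p ≫ θ.hom - c • b) ∈ radSq k X W := by
        simpa using hc
      have h2 := (hfg.source.isRadical_of_comp_mem_radSq hc').comp_left e
      rw [Preadditive.comp_sub, Linear.comp_smul, heb, smul_zero, sub_zero,
        ← Category.assoc, hee] at h2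
      apply hp
      simpa using h2.comp_right θ.inv
    rcases compl M hM _ hirr with hi | hi
    · exact main Y₁ hY₁ u₁ h₁ e₁ heh₁ gen₁ hi
    · rcases hY₂ with h | h
      · exact not_isZero_of_isLocalRing M (h.of_iso hi.some)
      · exact main Y₂ h v₁ h₂ e₂ heh₂ gen₂ hi
  have he0 : h ≫ s = 𝟙 Y := (sub_eq_zero.1 (he.eq_zero_of_idem hee)).symm
  let θ : Y ≅ Y₁ ⊞ Y₂ := ⟨h, s, he0, hs⟩
  have hsq := hfg.isWeakBicartesian θ
  have q1 : f ≫ θ.hom ≫ biprod.fst = u₁ := by simp [θ, h, e₁]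
  have q2 : f ≫ θ.hom ≫ biprod.snd = v₁ := by simp [θ, h, e₂]
  rw [q1, q2] at hsq
  refine ⟨_, _, ⟨(hg.comp_left _).comp_left _, fun h' => ?_⟩, ?_, hsq⟩
  -- If this component of `g` were in rad², minimality of the sink morphism would make the inclusion
  -- of `Y₁` radical, although it is a split monomorphism.
  · rw [← Category.assoc] at h'
    refine not_isRadical_of_comp_eq_id (r := θ.hom ≫ biprod.fst) ?_
      (id_ne_zero_of_isLocalRing Y₁) (hfg.sink.isRadical_of_comp_mem_radSq h')
    simp
  · rcases hY₂ with hz | hl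
    · exact Or.inl hz
    · refine Or.inr (IsIrred.neg ⟨(hg.comp_left _).comp_left _, fun h' => ?_⟩)
      rw [← Category.assoc] at h'
      refine not_isRadical_of_comp_eq_id (r := θ.hom ≫ biprod.snd) ?_
        (id_ne_zero_of_isLocalRing Y₂) (hfg.sink.isRadical_of_comp_mem_radSq h')
      simp

end Radical

/-! ### Interval systems and coherent choices of irreducible morphisms -/

section Interval

variable (k : Type w) [Field k] {C : Type u} [Category.{v} C] [Preadditive C] [Linear k C]

/-- A family of objects indexed by the intervals in `[A, B]`, connected by irreducible morphisms
`E a b ⟶ E a (b + 1)` and `E a b ⟶ E (a + 1) b` that span the irreducible morphisms, and such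
that the translate of `E (a + 1) (b + 1)` is `E a b`. -/
structure IsIntervalSystem (E : ℤ → ℤ → C) (A B : ℤ) : Prop where
  isZero : ∀ a b, b < a → IsZero (E a b)
  isLocalRing : ∀ a b, A ≤ a → a ≤ b → b ≤ B → IsLocalRing (End (E a b))
  not_iso : ∀ a b, A ≤ a → a ≤ b → b + 1 ≤ B → ¬ Nonempty (E a (b + 1) ≅ E (a + 1) b)
  exists_right : ∀ a b, A ≤ a → a ≤ b → b + 1 ≤ B → ∃ f : E a b ⟶ E a (b + 1), IsIrred k f
  gen_right : ∀ a b, A ≤ a → a ≤ b → b + 1 ≤ B → ∀ f g : E a b ⟶ E a (b + 1),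
    IsIrred k f → IsRadical g → ∃ c : k, g - c • f ∈ radSq k (E a b) (E a (b + 1))
  exists_down : ∀ a b, A ≤ a → a < b → b ≤ B → ∃ f : E a b ⟶ E (a + 1) b, IsIrred k f
  gen_down : ∀ a b, A ≤ a → a < b → b ≤ B → ∀ f g : E a b ⟶ E (a + 1) b,
    IsIrred k f → IsRadical g → ∃ c : k, g - c • f ∈ radSq k (E a b) (E (a + 1) b)
  compl : ∀ a b, A ≤ a → a ≤ b → b + 1 ≤ B → ∀ (M : C) (_ : IsLocalRing (End M))
    (f : E a b ⟶ M), IsIrred k f → Nonempty (M ≅ E a (b + 1)) ∨ Nonempty (M ≅ E (a + 1) b)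
  translate : ∀ a b, A ≤ a → a ≤ b → b + 1 ≤ B → IsTranslate (E a b) (E (a + 1) (b + 1))
  brick : ∀ a, A ≤ a → a ≤ B → ∀ f : E a a ⟶ E a a, ∃ c : k, f = c • 𝟙 (E a a)
  orth : ∀ a b, A ≤ a → a ≤ B → A ≤ b → b ≤ B → a ≠ b → ∀ f : E a a ⟶ E b b, f = 0

/-- A choice of irreducible morphisms making all the meshes weakly bicartesian squares. -/
structure IsCoherent (E : ℤ → ℤ → C) (A B : ℤ) (u : ∀ a b, E a b ⟶ E a (b + 1))
    (v : ∀ a b, E a b ⟶ E (a + 1) b) : Prop where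
  irr_u : ∀ a b, A ≤ a → a ≤ b → b + 1 ≤ B → IsIrred k (u a b)
  irr_v : ∀ a b, A ≤ a → a < b → b ≤ B → IsIrred k (v a b)
  sq : ∀ a b, A ≤ a → a ≤ b → b + 1 ≤ B →
    IsWeakBicartesian (u a b) (v a b) (v a (b + 1)) (u (a + 1) b)

variable {k}

/-- Dependent choice along the integers, starting at `a`. -/
lemma exists_int_seq {P : ℤ → Type*} [∀ n, Nonempty (P n)] (a : ℤ) (good : ∀ n, P n → Prop)
    (R : ∀ n, P n → P (n + 1) → Prop) (x₀ : P a) (h₀ : good a x₀)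
    (step : ∀ n, a ≤ n → ∀ x : P n, good n x → ∃ y : P (n + 1), good (n + 1) y ∧ R n x y) :
    ∃ f : ∀ n, P n, f a = x₀ ∧ ∀ n, a ≤ n → good n (f n) ∧ R n (f n) (f (n + 1)) := by
  classical
  let next : ∀ n, a ≤ n → P n → P (n + 1) := fun n hn x =>
    if h : good n x then (step n hn x h).choose else Classical.arbitrary _
  let f : ∀ n, P n := fun n =>
    Int.inductionOn' n a x₀ next (fun _ _ _ => Classical.arbitrary _)
  have f0 : f a = x₀ := Int.inductionOn'_self ..
  have fs : ∀ n (hn : a ≤ n), f (n + 1) = next n hn (f n) := fun n hn =>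
    Int.inductionOn'_add_one hn
  have hnext : ∀ n (hn : a ≤ n), good n (f n) → good (n + 1) (f (n + 1)) ∧ R n (f n) (f (n + 1)) := by
    intro n hn hg
    rw [fs n hn]
    simp only [next, dif_pos hg]
    exact (step n hn _ hg).choose_spec
  have hg : ∀ n, a ≤ n → good n (f n) := by
    intro n hn
    induction n, hn using Int.leInduction with
    | base => rw [f0]; exact h₀
    | succ n hn ih => exact (hnext n hn ih).1
  exact ⟨f, f0, fun n hn => ⟨hg n hn, (hnext n hn (hg n hn)).2⟩⟩

namespace IsIntervalSystem

variable {E : ℤ → ℤ → C} {A B : ℤ}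

/-- The choice proceeds row by row, a row being the objects with a fixed left endpoint. Once the
right arrows of row `a` are fixed, `b` runs upwards from `a`: the mesh starting in `E a b` is
completed from `u a b` and `v a b`, and this produces `v a (b + 1)` and `u (a + 1) b`. So each arrow
is determined by at most one mesh, and no compatibility has to be checked. The recursion needs a
first row, whence the lower bound `A`. -/
lemma exists_coherent [HasFiniteBiproducts C] (hKS : IsKrullSchmidt C)
    (H : IsIntervalSystem k E A B) : ∃ u v, IsCoherent k E A B u v := by
  classical
  have row : ∀ a, A ≤ a → ∀ u : ∀ b, E a b ⟶ E a (b + 1),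
      (∀ b, a ≤ b → b + 1 ≤ B → IsIrred k (u b)) →
      ∃ u' : ∀ b, E (a + 1) b ⟶ E (a + 1) (b + 1),
        (∀ b, a + 1 ≤ b → b + 1 ≤ B → IsIrred k (u' b)) ∧
        ∃ v : ∀ b, E a b ⟶ E (a + 1) b, (∀ b, a < b → b ≤ B → IsIrred k (v b)) ∧
          ∀ b, a ≤ b → b + 1 ≤ B → IsWeakBicartesian (u b) (v b) (v (b + 1)) (u' b) := by
    intro a ha u hu
    obtain ⟨v, -, hv⟩ := exists_int_seq (P := fun b => E a b ⟶ E (a + 1) b) a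
      (fun b v => a < b → b ≤ B → IsIrred k v)
      (fun b v v' => b + 1 ≤ B → ∃ u' : E (a + 1) b ⟶ E (a + 1) (b + 1),
        (a < b → IsIrred k u') ∧ IsWeakBicartesian (u b) v v' u')
      -- The down arrow out of `E a a` ends in the zero object `E (a + 1) a`, so the recursion
      -- starts with 0. Irreducibility is claimed only for `a < b`.
      0 (fun h => absurd h (lt_irrefl a)) (by
        intro b hab v hv
        by_cases hb : b + 1 ≤ B
        · have hz : ¬ a < b → IsZero (E (a + 1) b) := fun h => H.isZero _ _ (by omega)
          obtain ⟨v₂, u₂, h1, h2, h3⟩ := exists_mesh (k := k) hKS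
            (H.isLocalRing a b ha hab (by omega))
            (H.isLocalRing a (b + 1) ha (by omega) hb)
            (H.isLocalRing (a + 1) (b + 1) (by omega) (by omega) hb)
            (Y₂ := E (a + 1) b)
            (by
              by_cases h : a < b
              · exact Or.inr (H.isLocalRing _ _ (by omega) (by omega) (by omega))
              · exact Or.inl (hz h))
            (H.not_iso a b ha hab hb) (H.translate a b ha hab hb) (hu b hab hb)
            (v₁ := v) (by
              by_cases h : a < b
              · exact Or.inr (hv h (by omega))
              · exact Or.inl (hz h))
            (fun f hf => H.gen_right a b ha hab hb _ f (hu b hab hb) hf)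
            (fun f hf => by
              by_cases h : a < b
              · exact H.gen_down a b ha h (by omega) v f (hv h (by omega)) hf
              · refine ⟨0, ?_⟩
                rw [(hz h).eq_of_tgt (f - _) 0]
                exact zero_mem _)
            (H.compl a b ha hab hb)
          refine ⟨v₂, fun _ _ => h1, fun _ => ⟨u₂, fun h => h2.resolve_left fun hz' => ?_, h3⟩⟩
          have := H.isLocalRing (a + 1) b (by omega) (by omega) (by omega)
          exact not_isZero_of_isLocalRing _ hz'
        · exact ⟨0, fun _ h => absurd h hb, fun h => absurd h hb⟩)
    have hv' : ∀ b, ∃ u' : E (a + 1) b ⟶ E (a + 1) (b + 1), a ≤ b → b + 1 ≤ B →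
        (a < b → IsIrred k u') ∧ IsWeakBicartesian (u b) (v b) (v (b + 1)) u' := by
      intro b
      by_cases h : a ≤ b ∧ b + 1 ≤ B
      · obtain ⟨u', h'⟩ := (hv b h.1).2 h.2
        exact ⟨u', fun _ _ => h'⟩
      · exact ⟨0, fun h1 h2 => absurd ⟨h1, h2⟩ h⟩
    choose u' hu' using hv'
    exact ⟨u', fun b hb hb' => (hu' b (by omega) hb').1 (by omega), v,
      fun b hb hb' => (hv b hb.le).1 hb hb', fun b hb hb' => (hu' b hb hb').2⟩
  have hu₀ : ∀ b, ∃ f : E A b ⟶ E A (b + 1), A ≤ b → b + 1 ≤ B → IsIrred k f := by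
    intro b
    by_cases h : A ≤ b ∧ b + 1 ≤ B
    · obtain ⟨f, hf⟩ := H.exists_right A b le_rfl h.1 h.2
      exact ⟨f, fun _ _ => hf⟩
    · exact ⟨0, fun h1 h2 => absurd ⟨h1, h2⟩ h⟩
  choose u₀ hu₀ using hu₀
  obtain ⟨u, -, hu⟩ := exists_int_seq (P := fun a => ∀ b, E a b ⟶ E a (b + 1)) A
    (fun a u => ∀ b, a ≤ b → b + 1 ≤ B → IsIrred k (u b))
    (fun a u u' => ∃ v : ∀ b, E a b ⟶ E (a + 1) b, (∀ b, a < b → b ≤ B → IsIrred k (v b)) ∧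
          ∀ b, a ≤ b → b + 1 ≤ B → IsWeakBicartesian (u b) (v b) (v (b + 1)) (u' b))
    u₀ hu₀ row
  have hv : ∀ a, ∃ v : ∀ b, E a b ⟶ E (a + 1) b, A ≤ a → (∀ b, a < b → b ≤ B → IsIrred k (v b)) ∧
      ∀ b, a ≤ b → b + 1 ≤ B → IsWeakBicartesian (u a b) (v b) (v (b + 1)) (u (a + 1) b) := by
    intro a
    by_cases h : A ≤ a
    · obtain ⟨v, hv⟩ := (hu a h).2
      exact ⟨v, fun _ => hv⟩
    · exact ⟨fun _ => 0, fun h' => absurd h' h⟩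
  choose v hv using hv
  exact ⟨u, v, fun a b h1 h2 h3 => (hu a h1).1 b h2 h3, fun a b h1 h2 h3 => (hv a h1).1 b h2 h3,
    fun a b h1 h2 h3 => (hv a h1).2 b h2 h3⟩

/-! ### Morphism spaces between interval objects -/

section Hom

variable {u : ∀ a b, E a b ⟶ E a (b + 1)} {v : ∀ a b, E a b ⟶ E (a + 1) b}
  (H : IsIntervalSystem k E A B) (K : IsCoherent k E A B u v)

include H K

/-- Only the socle `E c c` can map to `E c d`. Induction on the length of `[c, d]`: as nothing maps
from `E x x` to the shorter `E c d`, the weak pullback property kills `p` as soon as its composite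
with the down arrow factors through `u (c + 1) d`. -/
lemma hom_simple_left_eq_zero (n : ℕ) : ∀ c d x : ℤ, A ≤ c → c ≤ d → d ≤ B → A ≤ x → x ≤ B →
    d < c + n → x ≠ c → ∀ p : E x x ⟶ E c d, p = 0 := by
  induction n with
  | zero => intro c d x h1 h2 h3 h4 h5 h6; omega
  | succ n ih =>
    intro c d x h1 h2 h3 h4 h5 h6 hx p
    rcases h2.eq_or_lt with rfl | h2
    · exact H.orth _ _ h4 h5 h1 h3 hx p
    obtain ⟨d, rfl⟩ : ∃ d', d = d' + 1 := ⟨d - 1, by ring⟩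
    have sq := K.sq c d h1 (by omega) h3
    have ih1 : ∀ w : E x x ⟶ E c d, w = 0 :=
      ih c d x h1 (by omega) (by omega) h4 h5 (by push_cast at h6; omega) hx
    suffices hq : ∃ q : E x x ⟶ E (c + 1) d, p ≫ v c (d + 1) = q ≫ u (c + 1) d by
      obtain ⟨q, hq⟩ := hq
      obtain ⟨t, ht, -⟩ := sq.exists_lift p q hq
      rw [← ht, ih1 t, zero_comp]
    -- Only for `x = c + 1` does the induction hypothesis not kill `p ≫ v c (d + 1)` at once. In
    -- that case it does kill the composite with the next down arrow, and the neighbouring square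
    -- provides the factorization.
    by_cases hxc : x = c + 1
    · subst hxc
      rcases (show c + 1 ≤ d ∨ c = d by omega) with hd | rfl
      · obtain ⟨d, rfl⟩ : ∃ d', d = d' + 1 := ⟨d - 1, by ring⟩
        obtain ⟨t, ht, -⟩ := (K.sq (c + 1) (d + 1) (by omega) (by omega) h3).exists_lift
          (p ≫ v c (d + 1 + 1)) 0 (by
            rw [zero_comp]
            exact ih (c + 1 + 1) (d + 1 + 1) (c + 1) (by omega) (by omega) h3 h4 h5
              (by push_cast at h6; omega) (by omega) _)
        exact ⟨t, ht.symm⟩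
      -- Here the composite is an endomorphism of a brick. A nonzero scalar would split the
      -- irreducible map `v c (c + 1)`.
      · obtain ⟨z, hz⟩ := H.brick (c + 1) h4 h5 (p ≫ v c (c + 1))
        have := H.isLocalRing (c + 1) (c + 1) h4 le_rfl h5
        have hz0 : z = 0 := by
          by_contra hz0
          refine not_isSplitEpi_of_isRadical (K.irr_v c (c + 1) h1 (by omega) h3).1
            (id_ne_zero_of_isLocalRing _) (IsSplitEpi.mk' ⟨z⁻¹ • p, ?_⟩)
          rw [Linear.smul_comp, hz, smul_smul, inv_mul_cancel₀ hz0, one_smul]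
        exact ⟨0, by rw [hz, hz0, zero_smul, zero_comp]⟩
    · refine ⟨0, ?_⟩
      rw [zero_comp]
      exact ih (c + 1) (d + 1) x (by omega) (by omega) h3 h4 h5 (by push_cast at h6; omega) hxc _

/-- The dual statement: `E a b` can map only to its top `E b b`. The chase now uses the weak pushout
property. -/
lemma hom_simple_right_eq_zero (n : ℕ) : ∀ a b x : ℤ, A ≤ a → a ≤ b → b ≤ B → A ≤ x → x ≤ B →
    b < a + n → x ≠ b → ∀ p : E a b ⟶ E x x, p = 0 := by
  induction n with
  | zero => intro c d x h1 h2 h3 h4 h5 h6; omega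
  | succ n ih =>
    intro a b x h1 h2 h3 h4 h5 h6 hx p
    rcases h2.eq_or_lt with rfl | h2
    · exact H.orth _ _ h1 h3 h4 h5 hx.symm p
    obtain ⟨b, rfl⟩ : ∃ d', b = d' + 1 := ⟨b - 1, by ring⟩
    have sq := K.sq a b h1 (by omega) h3
    suffices hq : ∃ q : E (a + 1) b ⟶ E x x, u a b ≫ p = v a b ≫ q by
      obtain ⟨q, hq⟩ := hq
      obtain ⟨t, ht, -⟩ := sq.exists_desc p q hq
      rw [← ht, ih (a + 1) (b + 1) x (by omega) (by omega) h3 h4 h5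
        (by push_cast at h6; omega) hx t, comp_zero]
    by_cases hxc : x = b
    · subst hxc
      rcases (show a + 1 ≤ x ∨ a = x by omega) with hd | rfl
      · obtain ⟨b, rfl⟩ : ∃ d', x = d' + 1 := ⟨x - 1, by ring⟩
        obtain ⟨t, ht, -⟩ := (K.sq a b (by omega) (by omega) (by omega)).exists_desc
          (u a (b + 1) ≫ p) 0 (by
            rw [comp_zero]
            exact ih a b (b + 1) (by omega) (by omega) (by omega) h4 h5
              (by push_cast at h6; omega) (by omega) _)
        exact ⟨t, ht.symm⟩
      · obtain ⟨z, hz⟩ := H.brick a h4 h5 (u a a ≫ p)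
        have := H.isLocalRing a a h4 le_rfl h5
        have hz0 : z = 0 := by
          by_contra hz0
          refine not_isSplitMono_of_isRadical (K.irr_u a a h1 le_rfl h3).1
            (id_ne_zero_of_isLocalRing _) (IsSplitMono.mk' ⟨z⁻¹ • p, ?_⟩)
          rw [Linear.comp_smul, hz, smul_smul, inv_mul_cancel₀ hz0, one_smul]
        exact ⟨0, by rw [hz, hz0, zero_smul, comp_zero]⟩
    · refine ⟨0, ?_⟩
      rw [comp_zero]
      exact ih a b x (by omega) (by omega) (by omega) h4 h5 (by push_cast at h6; omega) hxc _

/-- Informally, `p` vanishes on the socle `E a a`, because `a ≠ c`. The weak pushout squares of row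
`a` carry the factorization from `E a b` to `E a (b + 1)`. -/
lemma exists_eq_down_comp {a b c d : ℤ} (ha : A ≤ a) (hab : a ≤ b) (hb : b ≤ B) (hc : A ≤ c)
    (hcd : c ≤ d) (hd : d ≤ B) (hac : a ≠ c) (p : E a b ⟶ E c d) :
    ∃ t : E (a + 1) b ⟶ E c d, p = v a b ≫ t := by
  induction b, hab using Int.leInduction with
  | base =>
    refine ⟨0, ?_⟩
    rw [comp_zero]
    exact H.hom_simple_left_eq_zero K (d - c + 1).toNat c d a hc hcd hd ha hb (by omega) hac p
  | succ b hab ih =>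
    obtain ⟨t', ht'⟩ := ih (by omega) (u a b ≫ p)
    obtain ⟨t, ht, -⟩ := (K.sq a b ha hab hb).exists_desc p t' ht'
    exact ⟨t, ht.symm⟩

lemma exists_eq_comp_right {a b d : ℤ} (ha : A ≤ a) (hab : a ≤ b) (hb : b ≤ B)
    (hd : d + 1 ≤ B) (hbd : b ≠ d + 1) (n : ℕ) : ∀ c : ℤ, A ≤ c → c + n = d + 1 →
    ∀ p : E a b ⟶ E c (d + 1), ∃ t : E a b ⟶ E c d, p = t ≫ u c d := by
  induction n with
  | zero =>
    intro c hc hcd p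
    obtain rfl : c = d + 1 := by simpa using hcd
    refine ⟨0, ?_⟩
    rw [zero_comp]
    exact H.hom_simple_right_eq_zero K (b - a + 1).toNat a b _ ha hab hb hc hd (by omega)
      (Ne.symm hbd) p
  | succ n ih =>
    intro c hc hcd p
    push_cast at hcd
    obtain ⟨t', ht'⟩ := ih (c + 1) (by omega) (by omega) (p ≫ v c (d + 1))
    obtain ⟨t, ht, -⟩ := (K.sq c d hc (by omega) hd).exists_lift p t' ht'
    exact ⟨t, ht.symm⟩

lemma exists_eq_comp_right' {a b c d : ℤ} (ha : A ≤ a) (hab : a ≤ b) (hb : b ≤ B)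
    (hd : d + 1 ≤ B) (hbd : b ≠ d + 1) (hc : A ≤ c) (hcd : c ≤ d + 1)
    (p : E a b ⟶ E c (d + 1)) : ∃ t : E a b ⟶ E c d, p = t ≫ u c d :=
  H.exists_eq_comp_right K ha hab hb hd hbd (d + 1 - c).toNat c hc (by omega) p

/-- Factoring through the down arrow shortens the source from the left. The condition on `c`
survives each step and keeps `a ≠ c`, so the process runs until the source is zero. -/
lemma hom_eq_zero_of_left (n : ℕ) : ∀ {a b c d : ℤ}, A ≤ a → b ≤ B → A ≤ c →
    c ≤ d → d ≤ B → b < a + n → (c < a ∨ b < c) → ∀ p : E a b ⟶ E c d, p = 0 := by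
  induction n with
  | zero =>
    intro a b c d ha hb hc hcd hd hn h p
    exact (H.isZero a b (by simpa using hn)).eq_of_src _ _
  | succ n ih =>
    intro a b c d ha hb hc hcd hd hn h p
    rcases lt_or_ge b a with hab | hab
    · exact (H.isZero a b hab).eq_of_src _ _
    obtain ⟨t, rfl⟩ := H.exists_eq_down_comp K ha hab hb hc hcd hd (by omega) p
    rw [ih (by omega) hb hc hcd hd (by push_cast at hn; omega) (by omega) t, comp_zero]

lemma hom_eq_zero_of_right (n : ℕ) : ∀ {a b c d : ℤ}, A ≤ a → a ≤ b → b ≤ B → A ≤ c →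
    d ≤ B → d < c + n → d < b → ∀ p : E a b ⟶ E c d, p = 0 := by
  induction n with
  | zero =>
    intro a b c d ha hab hb hc hd hn h p
    exact (H.isZero c d (by simpa using hn)).eq_of_tgt _ _
  | succ n ih =>
    intro a b c d ha hab hb hc hd hn h p
    rcases lt_or_ge d c with hcd | hcd
    · exact (H.isZero c d hcd).eq_of_tgt _ _
    obtain ⟨d, rfl⟩ : ∃ d', d = d' + 1 := ⟨d - 1, by ring⟩
    obtain ⟨t, rfl⟩ := H.exists_eq_comp_right' K ha hab hb hd (by omega) hc hcd p
    rw [ih ha hab hb hc (by omega) (by push_cast at hn; omega) (by omega) t, zero_comp]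

lemma hom_eq_zero {a b c d : ℤ} (ha : A ≤ a) (hab : a ≤ b) (hb : b ≤ B) (hc : A ≤ c)
    (hcd : c ≤ d) (hd : d ≤ B) (h : ¬ (a ≤ c ∧ c ≤ b ∧ b ≤ d)) (p : E a b ⟶ E c d) : p = 0 := by
  rcases lt_or_ge d b with h' | h'
  · exact H.hom_eq_zero_of_right K (d - c + 1).toNat ha hab hb hc hd (by omega) h' p
  · exact H.hom_eq_zero_of_left K (b - a + 1).toNat ha hb hc hcd hd (by omega) (by omega) p

/-- By induction on `b`, an endomorphism of `E a (b + 1)` restricts along `u a b` to a scalar.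
Subtracting that scalar leaves a map that factors through `E (a + 1) (b + 1)`, from which nothing
goes back to `E a (b + 1)`. -/
lemma end_eq_smul {a b : ℤ} (ha : A ≤ a) (hab : a ≤ b) (hb : b ≤ B) (p : E a b ⟶ E a b) :
    ∃ c : k, p = c • 𝟙 _ := by
  induction b, hab using Int.leInduction with
  | base => exact H.brick a ha hb p
  | succ b hab ih =>
    obtain ⟨t, ht⟩ := H.exists_eq_comp_right' K ha hab (by omega) hb (by omega) ha (by omega)
      (u a b ≫ p)
    obtain ⟨c, rfl⟩ := ih (by omega) t
    obtain ⟨t, ht', -⟩ := (K.sq a b ha hab hb).exists_desc (p - c • 𝟙 _) 0 (by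
      simp [Preadditive.comp_sub, ht])
    refine ⟨c, ?_⟩
    rw [H.hom_eq_zero K (by omega) (by omega) hb ha (by omega) hb (by omega) t, comp_zero] at ht'
    exact sub_eq_zero.1 ht'.symm

lemma exists_span {a b c d : ℤ} (ha : A ≤ a) (hab : a ≤ b) (hb : b ≤ B)
    (hcd : c ≤ d) (hd : d ≤ B) (hac : a ≤ c) (hbd : b ≤ d) :
    ∃ s : E a b ⟶ E c d, ∀ p : E a b ⟶ E c d, ∃ z : k, p = z • s := by
  obtain ⟨n, hn⟩ := Int.le.dest hac
  induction n generalizing a with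
  | zero =>
    obtain rfl : a = c := by simpa using hn
    induction d, hbd using Int.leInduction with
    | base => exact ⟨𝟙 _, H.end_eq_smul K ha hab hb⟩
    | succ d hbd ih =>
      obtain ⟨s, hs⟩ := ih (by omega) (by omega)
      refine ⟨s ≫ u a d, fun p => ?_⟩
      obtain ⟨t, rfl⟩ := H.exists_eq_comp_right' K ha hab hb hd (by omega) ha hcd p
      obtain ⟨z, rfl⟩ := hs t
      exact ⟨z, by simp⟩
  | succ n ih =>
    by_cases hab' : a + 1 ≤ b
    · push_cast at hn
      obtain ⟨s, hs⟩ := ih (a := a + 1) (by omega) hab' (by omega) (by omega)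
      refine ⟨v a b ≫ s, fun p => ?_⟩
      obtain ⟨t, rfl⟩ := H.exists_eq_down_comp K ha hab hb (by omega) hcd hd (by omega) p
      obtain ⟨z, rfl⟩ := hs t
      exact ⟨z, by simp⟩
    · refine ⟨0, fun p => ⟨0, ?_⟩⟩
      rw [zero_smul]
      exact H.hom_eq_zero K ha hab hb (by omega) hcd hd (by omega) p

lemma exists_smul_eq {a b c d : ℤ} (ha : A ≤ a) (hab : a ≤ b) (hb : b ≤ B) (hc : A ≤ c)
    (hcd : c ≤ d) (hd : d ≤ B) (p q : E a b ⟶ E c d) (hp : p ≠ 0) : ∃ z : k, q = z • p := by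
  by_cases h : a ≤ c ∧ c ≤ b ∧ b ≤ d
  · obtain ⟨s, hs⟩ := H.exists_span K ha hab hb hcd hd h.1 h.2.2
    obtain ⟨x, rfl⟩ := hs p
    obtain ⟨y, rfl⟩ := hs q
    have hx : x ≠ 0 := by rintro rfl; simp at hp
    exact ⟨y * x⁻¹, by rw [smul_smul, inv_mul_cancel_right₀ hx]⟩
  · exact absurd (H.hom_eq_zero K ha hab hb hc hcd hd h p) hp

lemma comp_down_ne_zero_of_eq {a b c : ℤ} (ha : A ≤ a) (hac : a ≤ c) (hcb : c < b) (hb : b ≤ B)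
    (p : E a b ⟶ E c b) (hp : p ≠ 0) : p ≫ v c b ≠ 0 := by
  intro h
  obtain ⟨b, rfl⟩ : ∃ d', b = d' + 1 := ⟨b - 1, by ring⟩
  obtain ⟨t, ht, -⟩ := (K.sq c b (by omega) (by omega) hb).exists_lift p 0 (by rw [h, zero_comp])
  rw [H.hom_eq_zero K ha (by omega) hb (by omega) (by omega) (by omega) (by omega) t,
    zero_comp] at ht
  exact hp ht.symm

/-- Right arrows are prepended to the identity of `E a d`. If such a composite vanished, the
previous map would factor through an object with left endpoint `a + 1`, and there are no nonzero
maps from there to `E a d`. -/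
lemma exists_ne_zero_right {a b d : ℤ} (ha : A ≤ a) (hab : a ≤ b) (hbd : b ≤ d) (hd : d ≤ B) :
    ∃ p : E a b ⟶ E a d, p ≠ 0 := by
  obtain ⟨n, hn⟩ := Int.le.dest hbd
  induction n generalizing b with
  | zero =>
    obtain rfl : b = d := by simpa using hn
    have := H.isLocalRing a b ha hab hd
    exact ⟨𝟙 _, id_ne_zero_of_isLocalRing _⟩
  | succ n ih =>
    push_cast at hn
    obtain ⟨p, hp⟩ := ih (b := b + 1) (by omega) (by omega) (by omega)
    refine ⟨u a b ≫ p, fun h => hp ?_⟩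
    obtain ⟨t, ht, -⟩ := (K.sq a b ha hab (by omega)).exists_desc p 0 (by rw [h, comp_zero])
    rw [← ht, H.hom_eq_zero K (by omega) (by omega) (by omega) ha (by omega) hd (by omega) t,
      comp_zero]

/-- For `c = a`, a nonzero map to `E a (d + 1)` exists and factors through `u a d`, and the first
factor is a multiple of `p`. For larger `c`, a map killed by the right arrow lifts to one killed by
the right arrow in the row before. -/
lemma comp_right_ne_zero {a b c d : ℤ} (ha : A ≤ a) (hac : a ≤ c) (hcb : c ≤ b) (hbd : b ≤ d)
    (hd : d + 1 ≤ B) (p : E a b ⟶ E c d) (hp : p ≠ 0) : p ≫ u c d ≠ 0 := by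
  induction c, hac using Int.leInduction with
  | base =>
    intro h
    obtain ⟨q, hq⟩ := H.exists_ne_zero_right K ha hcb (show b ≤ d + 1 by omega) hd
    obtain ⟨t, rfl⟩ := H.exists_eq_comp_right' K ha hcb (by omega) hd (by omega) ha (by omega) q
    obtain ⟨z, rfl⟩ := H.exists_smul_eq K ha hcb (by omega) ha (by omega) (by omega) p t hp
    simp [h] at hq
  | succ c hac ih =>
    intro h
    obtain ⟨t, ht, ht'⟩ := (K.sq c d (by omega) (by omega) hd).exists_lift 0 p (by rw [h, zero_comp])
    have : t = 0 := by
      by_contra h0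
      exact ih (by omega) t h0 ht
    rw [this, zero_comp] at ht'
    exact hp ht'.symm

lemma comp_down_ne_zero {a b c d : ℤ} (ha : A ≤ a) (hac : a ≤ c) (hcb : c < b) (hbd : b ≤ d)
    (hd : d ≤ B) (p : E a b ⟶ E c d) (hp : p ≠ 0) : p ≫ v c d ≠ 0 := by
  induction d, hbd using Int.leInduction with
  | base => exact H.comp_down_ne_zero_of_eq K ha hac hcb hd p hp
  | succ d hbd ih =>
    obtain ⟨t, rfl⟩ := H.exists_eq_comp_right' K ha (by omega) (by omega) hd (by omega)
      (by omega) (by omega) p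
    have ht : t ≠ 0 := by rintro rfl; simp at hp
    rw [Category.assoc, (K.sq c d (by omega) (by omega) hd).w, ← Category.assoc]
    exact H.comp_right_ne_zero K ha (by omega) (by omega) hbd hd _ (ih (by omega) t ht)

end Hom

end IsIntervalSystem

variable (k) in
/-- The morphism spaces in a family of objects indexed by the intervals in `J` are as in the mesh
category of the corresponding translation quiver. -/
structure HasIntervalHoms (E : ℤ → ℤ → C) (J : Set ℤ) : Prop where
  id_ne_zero : ∀ a b, a ∈ J → b ∈ J → a ≤ b → 𝟙 (E a b) ≠ 0
  right_ne_zero : ∀ a b, a ∈ J → b ∈ J → b + 1 ∈ J → a ≤ b → ∃ f : E a b ⟶ E a (b + 1), f ≠ 0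
  down_ne_zero : ∀ a b, a ∈ J → a + 1 ∈ J → b ∈ J → a < b → ∃ f : E a b ⟶ E (a + 1) b, f ≠ 0
  eq_zero : ∀ a b c d, a ∈ J → b ∈ J → c ∈ J → d ∈ J → a ≤ b → c ≤ d →
    ¬ (a ≤ c ∧ c ≤ b ∧ b ≤ d) → ∀ p : E a b ⟶ E c d, p = 0
  exists_smul_eq : ∀ a b c d, a ∈ J → b ∈ J → c ∈ J → d ∈ J → a ≤ b → c ≤ d →
    ∀ p q : E a b ⟶ E c d, p ≠ 0 → ∃ z : k, q = z • p
  comp_right_ne_zero : ∀ a b c d, a ∈ J → b ∈ J → c ∈ J → d ∈ J → d + 1 ∈ J → a ≤ c → c ≤ b →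
    b ≤ d → ∀ (p : E a b ⟶ E c d) (q : E c d ⟶ E c (d + 1)), p ≠ 0 → q ≠ 0 → p ≫ q ≠ 0
  comp_down_ne_zero : ∀ a b c d, a ∈ J → b ∈ J → c ∈ J → d ∈ J → c + 1 ∈ J → a ≤ c → c < b →
    b ≤ d → ∀ (p : E a b ⟶ E c d) (q : E c d ⟶ E (c + 1) d), p ≠ 0 → q ≠ 0 → p ≫ q ≠ 0

/-- The conclusion no longer mentions the chosen `u` and `v`: every nonzero map parallel to an arrow
is a multiple of it. -/
lemma IsIntervalSystem.hasIntervalHoms_Icc [HasFiniteBiproducts C] (hKS : IsKrullSchmidt C)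
    {E : ℤ → ℤ → C} {A B : ℤ} (H : IsIntervalSystem k E A B) :
    HasIntervalHoms k E (Set.Icc A B) := by
  obtain ⟨u, v, K⟩ := H.exists_coherent hKS
  refine ⟨?_, ?_, ?_, ?_, ?_, ?_, ?_⟩
  · intro a b ha hb hab
    have := H.isLocalRing a b ha.1 hab hb.2
    exact id_ne_zero_of_isLocalRing _
  · intro a b ha hb hb' hab
    exact ⟨_, (K.irr_u a b ha.1 hab hb'.2).ne_zero⟩
  · intro a b ha ha' hb hab
    exact ⟨_, (K.irr_v a b ha.1 hab hb.2).ne_zero⟩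
  · intro a b c d ha hb hc hd hab hcd h p
    exact H.hom_eq_zero K ha.1 hab hb.2 hc.1 hcd hd.2 h p
  · intro a b c d ha hb hc hd hab hcd p q hp
    exact H.exists_smul_eq K ha.1 hab hb.2 hc.1 hcd hd.2 p q hp
  · intro a b c d ha hb hc hd hd' hac hcb hbd p q hp hq h
    obtain ⟨z, hz⟩ := H.exists_smul_eq K hc.1 (by omega) hd.2 hc.1 (by omega) hd'.2 q (u c d) hq
    refine H.comp_right_ne_zero K ha.1 hac hcb hbd hd'.2 p hp ?_
    rw [hz, Linear.comp_smul, h, smul_zero]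
  · intro a b c d ha hb hc hd hc' hac hcb hbd p q hp hq h
    obtain ⟨z, hz⟩ := H.exists_smul_eq K hc.1 (by omega) hd.2 hc'.1 (by omega) hd.2 q (v c d) hq
    refine H.comp_down_ne_zero K ha.1 hac hcb hbd hd.2 p hp ?_
    rw [hz, Linear.comp_smul, h, smul_zero]

/-- Each assertion involves finitely many endpoints. As it is independent of choices, the results on
finite intervals need not be glued, and `J` may be unbounded below. -/
lemma HasIntervalHoms.of_Icc {E : ℤ → ℤ → C} {J : Set ℤ}
    (h : ∀ A B, A ∈ J → B ∈ J → A ≤ B → HasIntervalHoms k E (Set.Icc A B)) :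
    HasIntervalHoms k E J := by
  have key : ∀ a b c d : ℤ, a ∈ J → b ∈ J → c ∈ J → d ∈ J → ∃ S : Set ℤ,
      a ∈ S ∧ b ∈ S ∧ c ∈ S ∧ d ∈ S ∧ HasIntervalHoms k E S := by
    intro a b c d ha hb hc hd
    have hmin : ∀ x y : ℤ, x ∈ J → y ∈ J → min x y ∈ J := fun x y hx hy => by
      rcases min_choice x y with h | h <;> rw [h] <;> assumption
    have hmax : ∀ x y : ℤ, x ∈ J → y ∈ J → max x y ∈ J := fun x y hx hy => by
      rcases max_choice x y with h | h <;> rw [h] <;> assumption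
    refine ⟨Set.Icc (min (min a b) (min c d)) (max (max a b) (max c d)), ?_, ?_, ?_, ?_,
      h _ _ (hmin _ _ (hmin _ _ ha hb) (hmin _ _ hc hd))
        (hmax _ _ (hmax _ _ ha hb) (hmax _ _ hc hd)) ?_⟩ <;>
      (try simp only [Set.mem_Icc]) <;> omega
  refine ⟨?_, ?_, ?_, ?_, ?_, ?_, ?_⟩
  · intro a b ha hb
    obtain ⟨S, h1, h2, -, -, hS⟩ := key a b a b ha hb ha hb
    exact hS.id_ne_zero a b h1 h2
  · intro a b ha hb hb'
    obtain ⟨S, h1, h2, h3, -, hS⟩ := key a b _ b ha hb hb' hb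
    exact hS.right_ne_zero a b h1 h2 h3
  · intro a b ha ha' hb
    obtain ⟨S, h1, h2, h3, -, hS⟩ := key a _ b b ha ha' hb hb
    exact hS.down_ne_zero a b h1 h2 h3
  · intro a b c d ha hb hc hd
    obtain ⟨S, h1, h2, h3, h4, hS⟩ := key a b c d ha hb hc hd
    exact hS.eq_zero a b c d h1 h2 h3 h4
  · intro a b c d ha hb hc hd
    obtain ⟨S, h1, h2, h3, h4, hS⟩ := key a b c d ha hb hc hd
    exact hS.exists_smul_eq a b c d h1 h2 h3 h4
  · intro a b c d ha hb hc hd hd' hac hcb hbd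
    exact (h a (d + 1) ha hd' (by omega)).comp_right_ne_zero a b c d ⟨by omega, by omega⟩
      ⟨by omega, by omega⟩ ⟨by omega, by omega⟩ ⟨by omega, by omega⟩ ⟨by omega, by omega⟩
      hac hcb hbd
  · intro a b c d ha hb hc hd hc' hac hcb hbd
    exact (h a d ha hd (by omega)).comp_down_ne_zero a b c d ⟨by omega, by omega⟩
      ⟨by omega, by omega⟩ ⟨by omega, by omega⟩ ⟨by omega, by omega⟩ ⟨by omega, by omega⟩
      hac hcb hbd

end Interval

/-! ### Interval coordinates and quasi-simple vertices -/

namespace ValuedTransQuiver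

variable {W W' : Type*}

/-- Coordinates identifying `T` with the translation quiver of the intervals `[α, β]` with
endpoints in `J`. -/
structure IsIntervalShape (T : ValuedTransQuiver W) (J : Set ℤ) (α β : W → ℤ) : Prop where
  ordConnected : J.OrdConnected
  left_mem : ∀ x, α x ∈ J
  right_mem : ∀ x, β x ∈ J
  le : ∀ x, α x ≤ β x
  ext : ∀ x y, α x = α y → β x = β y → x = y
  exists_eq : ∀ a b, a ∈ J → b ∈ J → a ≤ b → ∃ x, α x = a ∧ β x = b
  valTarget_eq : ∀ x y, T.valTarget x y =
    if (α y = α x ∧ β y = β x + 1) ∨ (α y = α x + 1 ∧ β y = β x) then 1 else 0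
  valSource_eq : ∀ x y, T.valSource x y =
    if (α y = α x ∧ β y = β x + 1) ∨ (α y = α x + 1 ∧ β y = β x) then 1 else 0
  tau_iff : ∀ x y, T.tau x y ↔ α y = α x + 1 ∧ β y = β x + 1

/-- A description of the vertices `[a, a]` that is invariant under isomorphisms. -/
def IsBottom (T : ValuedTransQuiver W) (x : W) : Prop :=
  Subsingleton W ∨ ({y | T.HasArrow y x}.Subsingleton ∧ {y | T.HasArrow x y}.Subsingleton ∧
    ∃ z, T.tau x z ∨ T.tau z x)

namespace IsIntervalShape

variable {T : ValuedTransQuiver W} {J : Set ℤ} {α β : W → ℤ}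

lemma hasArrow_iff (h : T.IsIntervalShape J α β) (x y : W) : T.HasArrow x y ↔
    (α y = α x ∧ β y = β x + 1) ∨ (α y = α x + 1 ∧ β y = β x) := by
  unfold HasArrow
  rw [h.valTarget_eq]
  split_ifs with h' <;> simp [h']

lemma of_iso {T' : ValuedTransQuiver W'} (h : T.IsIntervalShape J α β) (e : T'.Iso T) :
    T'.IsIntervalShape J (fun x => α (e.toFun x)) (fun x => β (e.toFun x)) where
  ordConnected := h.ordConnected
  left_mem _ := h.left_mem _
  right_mem _ := h.right_mem _
  le _ := h.le _
  ext _ _ h1 h2 := e.toEquiv.injective (h.ext _ _ h1 h2)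
  exists_eq a b ha hb hab := by
    obtain ⟨x, hx⟩ := h.exists_eq a b ha hb hab
    refine ⟨e.toEquiv.symm x, ?_⟩
    have : e.toFun (e.toEquiv.symm x) = x := e.toEquiv.apply_symm_apply x
    simpa only [this] using hx
  valTarget_eq x y := by rw [← e.valTarget_eq, h.valTarget_eq]
  valSource_eq x y := by rw [← e.valSource_eq, h.valSource_eq]
  tau_iff x y := by rw [← e.tau_iff, h.tau_iff]

lemma subsingleton_of_eq (h : T.IsIntervalShape J α β) {x : W} (hx : α x = β x) :
    {y | T.HasArrow y x}.Subsingleton ∧ {y | T.HasArrow x y}.Subsingleton := by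
  constructor <;> intro y hy z hz <;> rw [Set.mem_ofPred_eq, h.hasArrow_iff] at hy hz <;>
    have := h.le y <;> have := h.le z <;> apply h.ext <;> omega

lemma eq_of_subsingleton_right (h : T.IsIntervalShape J α β) {x : W}
    (hs : {y | T.HasArrow x y}.Subsingleton) (hJ : β x + 1 ∈ J) : α x = β x := by
  by_contra hne
  have h0 := h.le x
  have h1 : α x + 1 ∈ J :=
    h.ordConnected.out (h.left_mem x) (h.right_mem x) ⟨by omega, by omega⟩
  obtain ⟨y, hy⟩ := h.exists_eq _ _ (h.left_mem x) hJ (by omega)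
  obtain ⟨z, hz⟩ := h.exists_eq _ _ h1 (h.right_mem x) (by omega)
  have := hs (x := y) ((h.hasArrow_iff _ _).2 (by omega)) (y := z)
    ((h.hasArrow_iff _ _).2 (by omega))
  subst this
  omega

lemma eq_of_subsingleton_left (h : T.IsIntervalShape J α β) {x : W}
    (hs : {y | T.HasArrow y x}.Subsingleton) (hJ : α x - 1 ∈ J) : α x = β x := by
  by_contra hne
  have h0 := h.le x
  have h1 : β x - 1 ∈ J :=
    h.ordConnected.out (h.left_mem x) (h.right_mem x) ⟨by omega, by omega⟩
  obtain ⟨y, hy⟩ := h.exists_eq _ _ hJ (h.right_mem x) (by omega)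
  obtain ⟨z, hz⟩ := h.exists_eq _ _ (h.left_mem x) h1 (by omega)
  have := hs (x := y) ((h.hasArrow_iff _ _).2 (by omega)) (y := z)
    ((h.hasArrow_iff _ _).2 (by omega))
  subst this
  omega

/-- The top of a wing also has at most one neighbour on each side. It is excluded by the translation
clause, since an interval that can be shifted left or right within `J` has two predecessors or two
successors unless it is a point. The wing of rank 1 has no translation and is treated separately. -/
lemma isBottom_iff (h : T.IsIntervalShape J α β) (x : W) : T.IsBottom x ↔ α x = β x := by
  constructor
  · rintro (hW | ⟨h1, h2, z, hz⟩)
    · obtain ⟨y, hy⟩ := h.exists_eq _ _ (h.left_mem x) (h.left_mem x) le_rfl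
      obtain rfl := Subsingleton.elim x y
      omega
    · rw [h.tau_iff, h.tau_iff] at hz
      rcases hz with hz | hz
      · exact h.eq_of_subsingleton_right h2 (hz.2 ▸ h.right_mem z)
      · have := h.left_mem z
        exact h.eq_of_subsingleton_left h1 (by rwa [hz.1, add_sub_cancel_right])
  · intro hx
    by_cases hW : Subsingleton W
    · exact Or.inl hW
    refine Or.inr ⟨(h.subsingleton_of_eq hx).1, (h.subsingleton_of_eq hx).2, ?_⟩
    have : ∃ y, y ≠ x := by
      by_contra! hy
      exact hW ⟨fun a b => (hy a).trans (hy b).symm⟩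
    obtain ⟨y, hy⟩ := this
    have hy' : α y < α x ∨ β x < β y := by
      by_contra! h'
      have := h.le y
      exact hy (h.ext _ _ (by omega) (by omega))
    rcases hy' with hy' | hy'
    · have h1 : α x - 1 ∈ J :=
        h.ordConnected.out (h.left_mem y) (h.left_mem x) ⟨by omega, by omega⟩
      obtain ⟨z, hz⟩ := h.exists_eq _ _ h1 h1 le_rfl
      exact ⟨z, Or.inr ((h.tau_iff _ _).2 (by omega))⟩
    · have h1 : β x + 1 ∈ J :=
        h.ordConnected.out (h.right_mem x) (h.right_mem y) ⟨by omega, by omega⟩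
      obtain ⟨z, hz⟩ := h.exists_eq _ _ h1 h1 le_rfl
      exact ⟨z, Or.inl ((h.tau_iff _ _).2 (by omega))⟩

end IsIntervalShape

/-- The vertex `(m, i)` corresponds to the interval `[m, m + i]`. -/
lemma isIntervalShape_restrict_plus (S : Set (ℤ × ℕ)) (J : Set ℤ) (hJ : J.OrdConnected)
    (hS : ∀ m i, (m, i) ∈ S ↔ m ∈ J ∧ m + (i : ℤ) ∈ J) :
    ((repetition AInfPlus).restrict S).IsIntervalShape J (fun p => p.1.1)
      (fun p => p.1.1 + p.1.2) where
  ordConnected := hJ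
  left_mem p := ((hS _ _).1 p.2).1
  right_mem p := ((hS _ _).1 p.2).2
  le p := by omega
  ext := by
    rintro ⟨⟨m, i⟩, h⟩ ⟨⟨m', i'⟩, h'⟩ h1 h2
    simp only at h1 h2
    obtain rfl : m = m' := h1
    obtain rfl : i = i' := by omega
    rfl
  exists_eq a b ha hb hab := by
    refine ⟨⟨(a, (b - a).toNat), (hS _ _).2 ⟨ha, ?_⟩⟩, rfl, ?_⟩
    · rwa [show a + ((b - a).toNat : ℤ) = b by omega]
    · simp only
      omega
  valTarget_eq := by
    rintro ⟨⟨m, i⟩, h⟩ ⟨⟨m', i'⟩, h'⟩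
    simp only [restrict, repetition, AInfPlus]
    split_ifs <;> omega
  valSource_eq := by
    rintro ⟨⟨m, i⟩, h⟩ ⟨⟨m', i'⟩, h'⟩
    simp only [restrict, repetition, AInfPlus]
    split_ifs <;> omega
  tau_iff := by
    rintro ⟨⟨m, i⟩, h⟩ ⟨⟨m', i'⟩, h'⟩
    simp only [restrict, repetition]
    omega

lemma isIntervalShape_wing (n : ℕ) : (wing n).IsIntervalShape {a | 0 ≤ a ∧ a < n}
    (fun p => p.1.1) (fun p => p.1.1 + p.1.2) :=
  isIntervalShape_restrict_plus _ _
    ⟨fun x hx y hy z hz => ⟨hx.1.trans hz.1, hz.2.trans_lt hy.2⟩⟩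
    (fun m i => by simp only [Set.mem_ofPred_eq]; omega)

lemma isIntervalShape_NAInfPlus : NAInfPlus.IsIntervalShape {a | 0 ≤ a}
    (fun p => p.1.1) (fun p => p.1.1 + p.1.2) :=
  isIntervalShape_restrict_plus _ _
    ⟨fun x hx y hy z hz => le_trans hx hz.1⟩
    (fun m i => by simp only [Set.mem_ofPred_eq]; omega)

/-- With the opposite orientation, `(m, i)` corresponds to `[m - i, m]`. -/
lemma isIntervalShape_NegNAInfMinus : NegNAInfMinus.IsIntervalShape {a | a ≤ 0}
    (fun p => p.1.1 - p.1.2) (fun p => p.1.1) where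
  ordConnected := ⟨fun x hx y hy z hz => le_trans hz.2 hy⟩
  left_mem p := by
    have := p.2
    simp only [Set.mem_ofPred_eq] at this ⊢
    omega
  right_mem p := p.2
  le p := by omega
  ext := by
    rintro ⟨⟨m, i⟩, h⟩ ⟨⟨m', i'⟩, h'⟩ h1 h2
    simp only at h1 h2
    obtain rfl : m = m' := h2
    obtain rfl : i = i' := by omega
    rfl
  exists_eq a b ha hb hab := by
    refine ⟨⟨(b, (b - a).toNat), hb⟩, ?_, rfl⟩
    simp only
    omega
  valTarget_eq := by
    rintro ⟨⟨m, i⟩, h⟩ ⟨⟨m', i'⟩, h'⟩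
    simp only [NegNAInfMinus, restrict, repetition, AInfMinus]
    split_ifs <;> omega
  valSource_eq := by
    rintro ⟨⟨m, i⟩, h⟩ ⟨⟨m', i'⟩, h'⟩
    simp only [NegNAInfMinus, restrict, repetition, AInfMinus]
    split_ifs <;> omega
  tau_iff := by
    rintro ⟨⟨m, i⟩, h⟩ ⟨⟨m', i'⟩, h'⟩
    simp only [NegNAInfMinus, restrict, repetition]
    omega

lemma isIntervalShape_ZAInf : ZAInf.IsIntervalShape Set.univ
    (fun p => p.1) (fun p => p.1 + p.2) :=
  (isIntervalShape_restrict_plus Set.univ Set.univ Set.ordConnected_univ (by simp)).of_iso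
    { toEquiv := (Equiv.Set.univ _).symm
      valSource_eq := fun _ _ => rfl
      valTarget_eq := fun _ _ => rfl
      tau_iff := fun _ _ => Iff.rfl }

lemma IsAInfShape.exists_isIntervalShape {T : ValuedTransQuiver W} (hT : T.IsAInfShape) :
    ∃ J α β, T.IsIntervalShape J α β ∧ ((∀ a ∈ J, a + 1 ∈ J) ∨ (∀ a ∈ J, a - 1 ∈ J)) := by
  rcases hT with ⟨⟨e⟩⟩ | ⟨⟨e⟩⟩ | ⟨⟨e⟩⟩
  · exact ⟨_, _, _, isIntervalShape_ZAInf.of_iso e, by simp⟩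
  · exact ⟨_, _, _, isIntervalShape_NAInfPlus.of_iso e, Or.inl fun a (ha : 0 ≤ a) =>
      show 0 ≤ a + 1 by omega⟩
  · exact ⟨_, _, _, isIntervalShape_NegNAInfMinus.of_iso e, Or.inr fun a (ha : a ≤ 0) =>
      show a - 1 ≤ 0 by omega⟩

/-- Quasi-simplicity refers to some isomorphism with a model, not to the coordinates at hand.
Passing through the invariant `IsBottom` makes the two agree. -/
lemma IsQuasiSimple.isBottom {T : ValuedTransQuiver W} {x : W} (h : T.IsQuasiSimple x) :
    T.IsBottom x := by
  rcases h with ⟨n, e, he⟩ | ⟨hT, h1, h2⟩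
  · rw [((isIntervalShape_wing n).of_iso e).isBottom_iff]
    rw [he, Nat.cast_zero, add_zero]
  · obtain ⟨J, α, β, hJ, hJ' | hJ'⟩ := hT.exists_isIntervalShape
    · rw [hJ.isBottom_iff]
      exact hJ.eq_of_subsingleton_right h2 (hJ' _ (hJ.right_mem x))
    · rw [hJ.isBottom_iff]
      exact hJ.eq_of_subsingleton_left h1 (hJ' _ (hJ.left_mem x))

lemma exists_isIntervalShape {T : ValuedTransQuiver W} (hT : T.IsWing ∨ T.IsAInfShape) :
    ∃ J α β, T.IsIntervalShape J α β ∧ ∀ x, T.IsQuasiSimple x ↔ α x = β x := by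
  rcases hT with ⟨n, -, ⟨e⟩⟩ | hT
  · have h := (isIntervalShape_wing n).of_iso e
    refine ⟨_, _, _, h, fun x => ⟨fun hx => (h.isBottom_iff x).1 hx.isBottom, fun hx => ?_⟩⟩
    exact Or.inl ⟨n, e, by simpa using hx⟩
  · obtain ⟨J, α, β, h, -⟩ := hT.exists_isIntervalShape
    exact ⟨J, α, β, h, fun x => ⟨fun hx => (h.isBottom_iff x).1 hx.isBottom, fun hx =>
      Or.inr ⟨hT, h.subsingleton_of_eq hx⟩⟩⟩

end ValuedTransQuiver

/-! ### Morphisms in the mesh category -/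

namespace ValuedTransQuiver

variable {W : Type*} (k : Type w) [Field k] (T : ValuedTransQuiver W)

/-- The quotient functor from the path category to the mesh category. -/
noncomputable abbrev toMesh : PathCat k T ⥤ MeshCat k T := Quotient.functor (meshRel k T)

instance : (toMesh k T).Linear k := Quotient.linear_functor k (meshRel k T) (meshRel_smul k T)

/-- A vertex as an object of the mesh category. -/
abbrev meshObj (x : W) : MeshCat k T := ⟨pathObj k T x⟩

/-- The sum of the arrows between two vertices, in the mesh category. -/
noncomputable def meshArrow (x y : W) : meshObj k T x ⟶ meshObj k T y :=
  (toMesh k T).map (∑ i : Fin (T.valTarget x y), arrow k i)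

variable {k T}

lemma meshHom_induction {x : W} (P : ∀ y, (meshObj k T x ⟶ meshObj k T y) → Prop)
    (zero : ∀ y, P y 0) (add : ∀ y f g, P y f → P y g → P y (f + g))
    (smul : ∀ y (c : k) f, P y f → P y (c • f)) (id : P x (𝟙 _))
    (comp : ∀ y z (i : Fin (T.valTarget y z)) f, P y f → P z (f ≫ (toMesh k T).map (arrow k i)))
    (y : W) (f : meshObj k T x ⟶ meshObj k T y) : P y f := by
  have hpath : ∀ {y : Paths T.Vertex} (p : (Paths.of T.Vertex).obj x ⟶ y),
      P y ((toMesh k T).map ((Free.embedding k (Paths T.Vertex)).map p)) := by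
    apply Paths.induction_fixed_source
    · have e : (toMesh k T).map ((Free.embedding k (Paths T.Vertex)).map
          (𝟙 ((Paths.of T.Vertex).obj x))) = 𝟙 _ :=
        (congrArg (toMesh k T).map ((Free.embedding k _).map_id _)).trans ((toMesh k T).map_id _)
      exact (congrArg (P x) e).mpr id
    · intro y z p q hp
      have e : (toMesh k T).map ((Free.embedding k (Paths T.Vertex)).map
          (p ≫ (Paths.of T.Vertex).map q)) = (toMesh k T).map ((Free.embedding k _).map p) ≫
            (toMesh k T).map (arrow k q) :=
        (congrArg (toMesh k T).map ((Free.embedding k _).map_comp _ _)).trans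
          ((toMesh k T).map_comp _ _)
      exact (congrArg (P z) e).mpr (comp y z q _ hp)
  obtain ⟨f, rfl⟩ := (toMesh k T).map_surjective f
  induction f using Finsupp.induction_linear with
  | zero =>
    have := (toMesh k T).map_zero (pathObj k T x) (pathObj k T y)
    exact this ▸ zero y
  | add f g hf hg =>
    have := (toMesh k T).map_add (X := pathObj k T x) (Y := pathObj k T y) (f := f) (g := g)
    exact this ▸ add y _ _ hf hg
  | single p c =>
    have h1 : (Finsupp.single p c : pathObj k T x ⟶ pathObj k T y) =
        c • ((Free.embedding k (Paths T.Vertex)).map p : pathObj k T x ⟶ pathObj k T y) :=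
      (@Finsupp.smul_single_one (Quiver.Path (V := T.Vertex) x y) k _ p c).symm
    have e := (congrArg (toMesh k T).map h1).trans
      ((toMesh k T).map_smul c ((Free.embedding k (Paths T.Vertex)).map p :
        pathObj k T x ⟶ pathObj k T y))
    exact (congrArg (P y) e).mpr (smul y c _ (hpath p))

lemma toMesh_map_meshElement {x z : W} (h : T.tau x z) :
    (toMesh k T).map (meshElement k T x z) = 0 := by
  rw [← Functor.map_zero]
  refine CategoryTheory.Quotient.sound _ ?_
  change _ - _ ∈ _
  rw [sub_zero]
  exact Submodule.subset_span ⟨x, z, 𝟙 _, 𝟙 _, h, by simp⟩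

namespace IsIntervalShape

variable {J : Set ℤ} {α β : W → ℤ} (h : T.IsIntervalShape J α β)

include h

lemma valTarget_le_one (x y : W) : T.valTarget x y ≤ 1 := by
  rw [h.valTarget_eq]
  split_ifs <;> simp

lemma meshArrow_eq {x y : W} (i : Fin (T.valTarget x y)) :
    meshArrow k T x y = (toMesh k T).map (arrow k i) := by
  have := h.valTarget_le_one x y
  have : Subsingleton (Fin (T.valTarget x y)) := ⟨fun a b => by omega⟩
  rw [meshArrow, Fintype.sum_subsingleton _ i]

/-- The mesh element, for any translation quiver with at most single arrows. -/
lemma meshElement_eq (x z : W) : meshElement k T x z =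
    ∑ᶠ y, (∑ i : Fin (T.valTarget x y), arrow k i) ≫ ∑ j : Fin (T.valTarget y z), arrow k j := by
  unfold meshElement
  congr 1
  funext y
  rw [Preadditive.sum_comp]
  refine Finset.sum_congr rfl fun i _ => ?_
  rw [Preadditive.comp_sum]
  refine Finset.sum_congr rfl fun j _ => ?_
  have h1 := h.valTarget_le_one x y
  have h2 := h.valTarget_le_one y z
  rw [if_pos (by omega)]

/-- A mesh has a single middle vertex `[a, b + 1]` if it starts at the bottom, and the second one
`[a + 1, b]` otherwise. -/
lemma finsum_mesh {M : Type*} [AddCommMonoid M] {x z : W} (hxz : T.tau x z) (g : W → M)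
    (hg : ∀ y, ¬ T.HasArrow x y → g y = 0) :
    (α x = β x ∧ ∃ y, α y = α x ∧ β y = β x + 1 ∧ ∑ᶠ y, g y = g y) ∨
    (α x < β x ∧ ∃ y y', α y = α x ∧ β y = β x + 1 ∧ α y' = α x + 1 ∧ β y' = β x ∧
      ∑ᶠ y, g y = g y + g y') := by
  classical
  have h0 := h.le x
  rw [h.tau_iff] at hxz
  obtain ⟨y, hy⟩ := h.exists_eq (α x) (β x + 1) (h.left_mem x) (hxz.2 ▸ h.right_mem z) (by omega)
  rcases h0.eq_or_lt with h1 | h1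
  · refine Or.inl ⟨h1, y, hy.1, hy.2, finsum_eq_single _ _ fun y' hy' => hg _ fun ha => hy' ?_⟩
    rw [h.hasArrow_iff] at ha
    have := h.le y'
    exact h.ext _ _ (by omega) (by omega)
  · obtain ⟨y', hy'⟩ := h.exists_eq (α x + 1) (β x) (hxz.1 ▸ h.left_mem z) (h.right_mem x)
      (by omega)
    have hne : y ≠ y' := by rintro rfl; omega
    refine Or.inr ⟨h1, y, y', hy.1, hy.2, hy'.1, hy'.2, ?_⟩
    rw [finsum_eq_sum_of_support_subset (s := {y, y'}), Finset.sum_pair hne]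
    intro t ht
    by_contra ht'
    refine ht (hg t fun ha => ht' ?_)
    rw [h.hasArrow_iff] at ha
    simp only [Finset.coe_insert, Finset.coe_singleton, Set.mem_insert_iff,
      Set.mem_singleton_iff]
    rcases ha with ha | ha
    · exact Or.inl (h.ext _ _ (by omega) (by omega))
    · exact Or.inr (h.ext _ _ (by omega) (by omega))

lemma meshArrow_relation {x z : W} (hxz : T.tau x z) :
    (α x = β x ∧ ∃ y, α y = α x ∧ β y = β x + 1 ∧
      meshArrow k T x y ≫ meshArrow k T y z = 0) ∨
    (α x < β x ∧ ∃ y y', α y = α x ∧ β y = β x + 1 ∧ α y' = α x + 1 ∧ β y' = β x ∧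
      meshArrow k T x y ≫ meshArrow k T y z + meshArrow k T x y' ≫ meshArrow k T y' z = 0) := by
  have h1 := toMesh_map_meshElement (k := k) hxz
  rw [h.meshElement_eq] at h1
  have hg : ∀ y, ¬ T.HasArrow x y →
      (∑ i : Fin (T.valTarget x y), arrow k i) ≫ ∑ j : Fin (T.valTarget y z), arrow k j = 0 := by
    intro y hy
    have : T.valTarget x y = 0 := by simpa [HasArrow] using hy
    have : IsEmpty (Fin (T.valTarget x y)) := by rw [this]; infer_instance
    rw [Fintype.sum_empty, zero_comp]
  rcases h.finsum_mesh hxz _ hg with ⟨h2, y, hy, hy', h3⟩ | ⟨h2, y, y', hy1, hy2, hy3, hy4, h3⟩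
  · refine Or.inl ⟨h2, y, hy, hy', ?_⟩
    rw [h3, Functor.map_comp] at h1
    exact h1
  · refine Or.inr ⟨h2, y, y', hy1, hy2, hy3, hy4, ?_⟩
    rw [h3, Functor.map_add, Functor.map_comp, Functor.map_comp] at h1
    exact h1

/-- Between two vertices of the mesh category, all morphisms are multiples of one path, and they
vanish outside of the expected range. -/
theorem meshHom (x : W) : ∃ s : ∀ y, meshObj k T x ⟶ meshObj k T y,
    s x = 𝟙 _ ∧ (∀ y, ¬ (α x ≤ α y ∧ α y ≤ β x ∧ β x ≤ β y) → s y = 0) ∧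
    ∀ y (f : meshObj k T x ⟶ meshObj k T y), ∃ z : k, f = z • s y := by
  classical
  -- A total inverse `pt` of the coordinates, with the value `x` outside of their range, so that
  -- paths can be built by recursion over the integers.
  have hpt : ∀ c d, ∃ y : W, c ∈ J → d ∈ J → c ≤ d → α y = c ∧ β y = d := by
    intro c d
    by_cases hcd : c ∈ J ∧ d ∈ J ∧ c ≤ d
    · obtain ⟨y, hy⟩ := h.exists_eq c d hcd.1 hcd.2.1 hcd.2.2
      exact ⟨y, fun _ _ _ => hy⟩
    · exact ⟨x, fun h1 h2 h3 => absurd ⟨h1, h2, h3⟩ hcd⟩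
  choose pt hpt using hpt
  have pt_eq : ∀ y, pt (α y) (β y) = y := fun y => by
    have := hpt (α y) (β y) (h.left_mem y) (h.right_mem y) (h.le y)
    exact h.ext _ _ this.1 this.2
  obtain ⟨a, b, rfl, hab⟩ : ∃ a b, pt a b = x ∧ (α x = a ∧ β x = b) :=
    ⟨α x, β x, pt_eq x, rfl, rfl⟩
  have ha : a ∈ J := hab.1 ▸ h.left_mem _
  have hb : b ∈ J := hab.2 ▸ h.right_mem _
  have hle : a ≤ b := by have := h.le (pt a b); omega
  let m : ∀ c d c' d', meshObj k T (pt c d) ⟶ meshObj k T (pt c' d') :=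
    fun c d c' d' => meshArrow k T (pt c d) (pt c' d')
  have comm : ∀ c d, c ∈ J → d + 1 ∈ J → c < d →
      m c d c (d + 1) ≫ m c (d + 1) (c + 1) (d + 1) =
        -(m c d (c + 1) d ≫ m (c + 1) d (c + 1) (d + 1)) := by
    intro c d hc hd hcd
    have hc1 : c + 1 ∈ J := h.ordConnected.out hc hd ⟨by omega, by omega⟩
    have hd1 : d ∈ J := h.ordConnected.out hc hd ⟨by omega, by omega⟩
    have e1 := hpt c d hc hd1 (by omega)
    have e2 := hpt (c + 1) (d + 1) hc1 hd (by omega)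
    have e3 := hpt c (d + 1) hc hd (by omega)
    have e4 := hpt (c + 1) d hc1 hd1 (by omega)
    rcases h.meshArrow_relation (k := k) ((h.tau_iff (pt c d) (pt (c + 1) (d + 1))).2 (by omega))
      with ⟨h2, -⟩ | ⟨h2, y, y', hy1, hy2, hy3, hy4, h3⟩
    · omega
    · obtain rfl : y = pt c (d + 1) := h.ext _ _ (by omega) (by omega)
      obtain rfl : y' = pt (c + 1) d := h.ext _ _ (by omega) (by omega)
      exact eq_neg_of_add_eq_zero_left h3
  have comm0 : ∀ c, c ∈ J → c + 1 ∈ J → m c c c (c + 1) ≫ m c (c + 1) (c + 1) (c + 1) = 0 := by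
    intro c hc hc1
    have e1 := hpt c c hc hc le_rfl
    have e2 := hpt (c + 1) (c + 1) hc1 hc1 le_rfl
    have e3 := hpt c (c + 1) hc hc1 (by omega)
    rcases h.meshArrow_relation (k := k) ((h.tau_iff (pt c c) (pt (c + 1) (c + 1))).2 (by omega))
      with ⟨h2, y, hy1, hy2, h3⟩ | ⟨h2, -⟩
    · obtain rfl : y = pt c (c + 1) := h.ext _ _ (by omega) (by omega)
      exact h3
    · omega
  -- The normal form of a path: down from `[a, b]` to `[c, b]` (`s₁`), then right to `[c, d]`
  -- (`s₂`).
  obtain ⟨s₁, hs₁0, hs₁⟩ := exists_int_seq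
    (P := fun c => meshObj k T (pt a b) ⟶ meshObj k T (pt c b)) a
    (fun _ _ => True) (fun c f g => g = f ≫ m c b (c + 1) b) (𝟙 _) trivial
    (fun c _ f _ => ⟨_, trivial, rfl⟩)
  have hs₂ : ∀ c, ∃ s₂ : ∀ d, meshObj k T (pt a b) ⟶ meshObj k T (pt c d),
      s₂ b = s₁ c ∧ ∀ d, b ≤ d → s₂ (d + 1) = s₂ d ≫ m c d c (d + 1) := by
    intro c
    obtain ⟨s, hs0, hs⟩ := exists_int_seq
      (P := fun d => meshObj k T (pt a b) ⟶ meshObj k T (pt c d)) b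
      (fun _ _ => True) (fun d f g => g = f ≫ m c d c (d + 1)) (s₁ c) trivial
      (fun c _ f _ => ⟨_, trivial, rfl⟩)
    exact ⟨s, hs0, fun d hd => (hs d hd).2⟩
  choose s₂ hs₂0 hs₂ using hs₂
  -- A down arrow appended to a normal form is moved past the right arrows by the mesh relations,
  -- each costing a sign.
  have down : ∀ c d, a ≤ c → b ≤ d → c + 1 ≤ b → d ∈ J → ∃ z : k,
      s₂ c d ≫ m c d (c + 1) d = z • s₂ (c + 1) d := by
    intro c d hc hd hcb hdJ
    induction d, hd using Int.leInduction with
    | base => exact ⟨1, by rw [hs₂0, hs₂0, one_smul, (hs₁ c hc).2]⟩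
    | succ d hd ih =>
      obtain ⟨z, hz⟩ := ih (h.ordConnected.out hb hdJ ⟨by omega, by omega⟩)
      refine ⟨-z, ?_⟩
      rw [hs₂ c d hd, Category.assoc, comm c d (h.ordConnected.out ha hb ⟨by omega, by omega⟩)
        hdJ (by omega), Preadditive.comp_neg, ← Category.assoc, hz, hs₂ (c + 1) d hd,
        Linear.smul_comp, neg_smul]
  -- Leaving the range through `c = b`: moved to the front, the down arrow meets the zero relation
  -- of the mesh starting at the bottom vertex `[b, b]`.
  have down0 : ∀ d, b < d → d ∈ J → s₂ b d ≫ m b d (b + 1) d = 0 := by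
    intro d hd hdJ
    obtain ⟨d, rfl⟩ : ∃ d', d = d' + 1 := ⟨d - 1, by ring⟩
    have hd' : b ≤ d := by omega
    induction d, hd' using Int.leInduction with
    | base => rw [hs₂ b b le_rfl, Category.assoc, comm0 b hb hdJ, comp_zero]
    | succ d hd' ih =>
      rw [hs₂ b (d + 1) (by omega), Category.assoc, comm b (d + 1) hb hdJ (by omega),
        Preadditive.comp_neg, ← Category.assoc,
        ih (by omega) (h.ordConnected.out hb hdJ ⟨by omega, by omega⟩), zero_comp, neg_zero]
  let s : ∀ c d, meshObj k T (pt a b) ⟶ meshObj k T (pt c d) := fun c d =>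
    if a ≤ c ∧ c ≤ b ∧ b ≤ d then s₂ c d else 0
  have sab : s a b = 𝟙 _ := by
    simp only [s]
    rw [if_pos (by omega), hs₂0, hs₁0]
  refine ⟨fun y => s (α y) (β y) ≫ eqToHom (congrArg _ (pt_eq y)), ?_, ?_, ?_⟩
  -- The equality `pt (α y) (β y) = y` is only propositional. Generalizing the coordinates allows
  -- the `eqToHom` to be removed by substitution.
  · have key : ∀ c d (hc : pt c d = pt a b), c = a → d = b →
        s c d ≫ eqToHom (congrArg (meshObj k T) hc) = 𝟙 _ := by
      rintro c d hc rfl rfl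
      rw [sab]; simp
    exact key _ _ (pt_eq _) hab.1 hab.2
  · intro y hy
    rw [hab.1, hab.2] at hy
    simp only [s]
    rw [if_neg hy, zero_comp]
  have step : ∀ c d c' d' (f : meshObj k T (pt a b) ⟶ meshObj k T (pt c d)),
      c ∈ J → d ∈ J → c ≤ d → c' ∈ J → d' ∈ J → c' ≤ d' →
      ((c' = c ∧ d' = d + 1) ∨ (c' = c + 1 ∧ d' = d)) →
      (∃ z : k, f = z • s c d) → ∃ z : k, f ≫ m c d c' d' = z • s c' d' := by
    rintro c d c' d' f hc hd hcd hc' hd' hcd' hh ⟨z, rfl⟩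
    simp only [s]
    by_cases hin : a ≤ c ∧ c ≤ b ∧ b ≤ d
    · rw [if_pos hin]
      rcases hh with ⟨rfl, rfl⟩ | ⟨rfl, rfl⟩
      · rw [if_pos (by omega), hs₂ _ _ hin.2.2]
        exact ⟨z, by rw [Linear.smul_comp]⟩
      · rcases hin.2.1.eq_or_lt with rfl | hcb
        · rw [if_neg (by omega), Linear.smul_comp, down0 _ (by omega) hd']
          exact ⟨0, by simp⟩
        · rw [if_pos (by omega)]
          obtain ⟨z', hz'⟩ := down c d' hin.1 hin.2.2 (by omega) hd'
          exact ⟨z * z', by rw [Linear.smul_comp, hz', smul_smul]⟩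
    · rw [if_neg hin]
      exact ⟨0, by simp⟩
  intro y f
  have hP := meshHom_induction (k := k) (T := T) (x := pt a b)
    (fun y f => ∃ z : k, f = z • (s (α y) (β y) ≫ eqToHom (congrArg (meshObj k T) (pt_eq y))))
    (fun y => ⟨0, by simp⟩)
    (by rintro y _ _ ⟨z, rfl⟩ ⟨z', rfl⟩; exact ⟨z + z', by rw [add_smul]⟩)
    (by rintro y c _ ⟨z, rfl⟩; exact ⟨c * z, by rw [smul_smul]⟩) ?_ ?_ y f
  · exact hP
  · refine ⟨1, ?_⟩
    have key : ∀ c d (hc : pt c d = pt a b), c = a → d = b →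
        𝟙 _ = (1 : k) • (s c d ≫ eqToHom (congrArg (meshObj k T) hc)) := by
      rintro c d hc rfl rfl
      rw [sab]; simp
    exact key _ _ (pt_eq _) hab.1 hab.2
  · intro y z i f hf
    have key : ∀ c d (hc : pt c d = y) c' d' (hc' : pt c' d' = z), α y = c → β y = d → α z = c' →
        β z = d' → (∃ r : k, f = r • (s c d ≫ eqToHom (congrArg (meshObj k T) hc))) →
        ∃ r : k, f ≫ (toMesh k T).map (arrow k i) =
          r • (s c' d' ≫ eqToHom (congrArg (meshObj k T) hc')) := by
      rintro c d rfl c' d' rfl h1 h2 h3 h4 hf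
      have harr : T.HasArrow (pt c d) (pt c' d') := Fin.pos i
      rw [h.hasArrow_iff, h1, h2, h3, h4] at harr
      have hl := h.le (pt c d)
      have hl' := h.le (pt c' d')
      simp only [eqToHom_refl, Category.comp_id] at hf ⊢
      rw [← h.meshArrow_eq i]
      exact step c d c' d' f (h1 ▸ h.left_mem _) (h2 ▸ h.right_mem _) (by omega)
        (h3 ▸ h.left_mem _) (h4 ▸ h.right_mem _) (by omega) harr hf
    exact key _ _ (pt_eq y) _ _ (pt_eq z) rfl rfl rfl rfl hf

end IsIntervalShape

end ValuedTransQuiver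

/-! ### Linear extension of functors to the linear completion -/

section FreeLift

variable (k : Type w) [Field k] {P : Type*} [Category P] {D : Type*} [Category D]
  [Preadditive D] [Linear k D]

/-- A morphism as a morphism of the linear completion. -/
noncomputable def freeOfMap {X Y : P} (f : X ⟶ Y) : Free.of k X ⟶ Free.of k Y :=
  (Free.embedding k P).map f

/-- The action of the linear extension of a functor on morphisms. -/
noncomputable def freeLiftMap (F : P ⥤ D) (X Y : P) :
    (Free.of k X ⟶ Free.of k Y) →ₗ[k] (F.obj X ⟶ F.obj Y) :=
  Finsupp.linearCombination k (fun f : X ⟶ Y => F.map f)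

variable {k} in
lemma freeLiftMap_freeOfMap (F : P ⥤ D) {X Y : P} (f : X ⟶ Y) :
    freeLiftMap k F X Y (freeOfMap k f) = F.map f :=
  (Finsupp.linearCombination_single k (1 : k) f).trans (one_smul k _)

lemma freeOfMap_comp {X Y Z : P} (f : X ⟶ Y) (g : Y ⟶ Z) :
    freeOfMap k (f ≫ g) = freeOfMap k f ≫ freeOfMap k g :=
  (Free.embedding k P).map_comp f g

variable {k} in
lemma freeHom_induction {X Y : P} (p : (Free.of k X ⟶ Free.of k Y) → Prop) (zero : p 0)
    (add : ∀ f g, p f → p g → p (f + g)) (smul : ∀ (c : k) (f : X ⟶ Y), p (c • freeOfMap k f))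
    (f : Free.of k X ⟶ Free.of k Y) : p f := by
  refine Finsupp.induction_linear (motive := p) f zero add fun f c => ?_
  have h1 : (Finsupp.single f c : Free.of k X ⟶ Free.of k Y) = c • freeOfMap k f :=
    (@Finsupp.smul_single_one (X ⟶ Y) k _ f c).symm
  exact (congrArg p h1).mpr (smul c f)

lemma freeLiftMap_comp (F : P ⥤ D) {X Y Z : P} (f : Free.of k X ⟶ Free.of k Y)
    (g : Free.of k Y ⟶ Free.of k Z) :
    freeLiftMap k F X Z (f ≫ g) = freeLiftMap k F X Y f ≫ freeLiftMap k F Y Z g := by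
  induction f using freeHom_induction with
  | zero => rw [zero_comp, map_zero, map_zero, zero_comp]
  | add f f' h h' => rw [Preadditive.add_comp, map_add, map_add, Preadditive.add_comp, h, h']
  | smul c f =>
    induction g using freeHom_induction with
    | zero => rw [comp_zero, map_zero, map_zero, comp_zero]
    | add g g' h h' => rw [Preadditive.comp_add, map_add, map_add, Preadditive.comp_add, h, h']
    | smul c' g =>
      rw [Linear.smul_comp, Linear.comp_smul, ← freeOfMap_comp, map_smul, map_smul, map_smul,
        map_smul, freeLiftMap_freeOfMap, freeLiftMap_freeOfMap, freeLiftMap_freeOfMap,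
        F.map_comp, Linear.smul_comp, Linear.comp_smul]

/-- The linear extension of a functor to the linear completion of its source. -/
noncomputable def freeLift (F : P ⥤ D) : Free k P ⥤ D where
  obj X := F.obj X
  map {X Y} f := freeLiftMap k F X Y f
  map_id X := ((freeLiftMap_freeOfMap F (𝟙 (show P from X)))).trans (F.map_id _)
  map_comp f g := freeLiftMap_comp k F f g

end FreeLift

/-! ### The functor from the mesh category -/

namespace ValuedTransQuiver

variable (k : Type w) [Field k] {C : Type u} [Category.{v} C] [Preadditive C] [Linear k C]
variable {W : Type*}

/-- The morphism spaces between the objects `X x` are as in the mesh category of the translation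
quiver of intervals. -/
structure HasMeshHoms (T : ValuedTransQuiver W) (α β : W → ℤ) (X : W → C) : Prop where
  id_ne_zero : ∀ x, 𝟙 (X x) ≠ 0
  arrow_ne_zero : ∀ x y, T.HasArrow x y → ∃ f : X x ⟶ X y, f ≠ 0
  eq_zero : ∀ x y, ¬ (α x ≤ α y ∧ α y ≤ β x ∧ β x ≤ β y) → ∀ p : X x ⟶ X y, p = 0
  exists_smul_eq : ∀ x y (p q : X x ⟶ X y), p ≠ 0 → ∃ z : k, q = z • p
  comp_ne_zero : ∀ x y z, T.HasArrow y z → α x ≤ α y → α z ≤ β x → β x ≤ β y →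
    ∀ (p : X x ⟶ X y) (q : X y ⟶ X z), p ≠ 0 → q ≠ 0 → p ≫ q ≠ 0

variable {k} {T : ValuedTransQuiver W} {J : Set ℤ} {α β : W → ℤ} {X : W → C}

/-- The choice of morphisms satisfying the mesh relations. -/
lemma HasMeshHoms.exists_arrows (h : T.IsIntervalShape J α β) (hX : HasMeshHoms k T α β X) :
    ∃ φ : ∀ x y, X x ⟶ X y, (∀ x y, T.HasArrow x y → φ x y ≠ 0) ∧
      (∀ x y z, T.tau x z → α x = β x → α y = α x → β y = β x + 1 → φ x y ≫ φ y z = 0) ∧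
      ∀ x y y' z, T.tau x z → α y = α x → β y = β x + 1 → α y' = α x + 1 → β y' = β x →
        φ x y ≫ φ y z + φ x y' ≫ φ y' z = 0 := by
  classical
  have hf : ∀ x y, ∃ f : X x ⟶ X y, T.HasArrow x y → f ≠ 0 := fun x y => by
    by_cases hxy : T.HasArrow x y
    · obtain ⟨f, hf⟩ := hX.arrow_ne_zero x y hxy
      exact ⟨f, fun _ => hf⟩
    · exact ⟨0, fun h => absurd h hxy⟩
  choose f hf using hf
  -- Both composites around a mesh with two middle vertices are nonzero in an at most
  -- one-dimensional space, hence nonzero multiples of each other. The value 1 is a default where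
  -- there is no such mesh.
  have hν : ∀ a b, ∃ ν : k, ν ≠ 0 ∧ ∀ x y y' z, α x = a → β x = b → T.tau x z → α y = a →
      β y = b + 1 → α y' = a + 1 → β y' = b → f x y ≫ f y z = ν • (f x y' ≫ f y' z) := by
    intro a b
    by_cases hex : ∃ x y y' z, α x = a ∧ β x = b ∧ T.tau x z ∧ α y = a ∧
      β y = b + 1 ∧ α y' = a + 1 ∧ β y' = b
    · obtain ⟨x, y, y', z, hxa, hxb, hxz, h1, h2, h3, h4⟩ := hex
      have hle := h.le y'
      have hz := (h.tau_iff x z).1 hxz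
      have ne1 : f x y ≫ f y z ≠ 0 :=
        hX.comp_ne_zero x y z ((h.hasArrow_iff _ _).2 (by omega)) (by omega) (by omega) (by omega)
          _ _ (hf _ _ ((h.hasArrow_iff _ _).2 (by omega)))
          (hf _ _ ((h.hasArrow_iff _ _).2 (by omega)))
      have ne2 : f x y' ≫ f y' z ≠ 0 :=
        hX.comp_ne_zero x y' z ((h.hasArrow_iff _ _).2 (by omega)) (by omega) (by omega) (by omega)
          _ _ (hf _ _ ((h.hasArrow_iff _ _).2 (by omega)))
          (hf _ _ ((h.hasArrow_iff _ _).2 (by omega)))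
      obtain ⟨ν, hν⟩ := hX.exists_smul_eq x z _ (f x y ≫ f y z) ne2
      refine ⟨ν, ?_, ?_⟩
      · rintro rfl
        rw [zero_smul] at hν
        exact ne1 hν
      · intro x₁ y₁ y₁' z₁ hxa₁ hxb₁ hxz₁ h1₁ h2₁ h3₁ h4₁
        have hz₁ := (h.tau_iff x₁ z₁).1 hxz₁
        obtain rfl : x₁ = x := h.ext _ _ (by omega) (by omega)
        obtain rfl : y₁ = y := h.ext _ _ (by omega) (by omega)
        obtain rfl : y₁' = y' := h.ext _ _ (by omega) (by omega)
        obtain rfl : z₁ = z := h.ext _ _ (by omega) (by omega)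
        exact hν
    · exact ⟨1, one_ne_zero, fun x y y' z h1 h2 h3 h4 h5 h6 h7 =>
        absurd ⟨x, y, y', z, h1, h2, h3, h4, h5, h6, h7⟩ hex⟩
  choose ν hν0 hν using hν
  -- Only the down arrows are rescaled, the one out of `[a, b]` by `c a b`. The mesh starting in
  -- `[a, b]` then involves only `c a b` and `c a (b + 1)`, so the recursion along each row meets no
  -- further condition.
  have hc : ∀ a, ∃ c : ℤ → k, ∀ b, a ≤ b → c b ≠ 0 ∧ c (b + 1) * ν a b + c b = 0 := by
    intro a
    obtain ⟨c, -, hc⟩ := exists_int_seq (P := fun _ => k) a (fun _ c => c ≠ 0)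
      (fun b c c' => c' * ν a b + c = 0) 1 one_ne_zero (fun b _ c hc =>
        ⟨-c * (ν a b)⁻¹, mul_ne_zero (neg_ne_zero.2 hc) (inv_ne_zero (hν0 a b)), by
          rw [inv_mul_cancel_right₀ (hν0 a b), neg_add_cancel]⟩)
    exact ⟨c, hc⟩
  choose c hc using hc
  let φ : ∀ x y, X x ⟶ X y := fun x y => if α y = α x then f x y else c (α x) (β x) • f x y
  have hφr : ∀ x y, α y = α x → φ x y = f x y := fun x y h => if_pos h
  have hφd : ∀ x y, α y ≠ α x → φ x y = c (α x) (β x) • f x y := fun x y h => if_neg h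
  refine ⟨φ, ?_, ?_, ?_⟩
  · intro x y hxy
    by_cases h1 : α y = α x
    · rw [hφr _ _ h1]
      exact hf x y hxy
    · rw [hφd _ _ h1]
      exact smul_ne_zero (hc _ _ (h.le x)).1 (hf x y hxy)
  · intro x y z hxz h1 h2 h3
    rw [h.tau_iff] at hxz
    exact hX.eq_zero x z (by omega) _
  · intro x y y' z hxz h1 h2 h3 h4
    have hz := (h.tau_iff x z).1 hxz
    rw [hφr x y h1, hφd y z (by omega), hφd x y' (by omega), hφr y' z (by omega),
      Linear.comp_smul, Linear.smul_comp, hν _ _ x y y' z rfl rfl hxz h1 h2 h3 h4, smul_smul,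
      ← add_smul, h1, h2, (hc _ _ (h.le x)).2, zero_smul]

theorem HasMeshHoms.exists_equivalence (h : T.IsIntervalShape J α β)
    (hX : HasMeshHoms k T α β X) :
    ∃ F : MeshCat k T ⥤ InducedCategory C X,
      F.Additive ∧ F.Linear k ∧ F.IsEquivalence ∧ ∀ x : W, F.obj ⟨x⟩ = x := by
  obtain ⟨φ, hφ0, hφ1, hφ2⟩ := hX.exists_arrows h
  let o : W → InducedCategory C X := fun x => x
  let G : Paths T.Vertex ⥤ InducedCategory C X :=
    Paths.lift (V := T.Vertex) { obj := fun x => o x, map := fun {x y} _ => InducedCategory.homMk (φ x y) }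
  let L : PathCat k T ⥤ InducedCategory C X := freeLift k G
  have hLarrow : ∀ {x y : W} (i : Fin (T.valTarget x y)),
      L.map (arrow k i) = (InducedCategory.homMk (φ x y) : o x ⟶ o y) :=
    fun {x y} i => (freeLiftMap_freeOfMap G _).trans (Paths.lift_toPath _ _)
  have hLadd : L.Additive := ⟨fun {a b f g} => map_add (freeLiftMap k G a b) f g⟩
  have hLlin : L.Linear k := ⟨fun {a b} f c => map_smul (freeLiftMap k G a b) c f⟩
  have hLsum : ∀ x y, T.HasArrow x y → L.map (∑ i : Fin (T.valTarget x y), arrow k i) =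
      (InducedCategory.homMk (φ x y) : o x ⟶ o y) := by
    intro x y hxy
    have := h.valTarget_le_one x y
    have : Subsingleton (Fin (T.valTarget x y)) := ⟨fun a b => by omega⟩
    rw [Fintype.sum_subsingleton _ ⟨0, hxy⟩]
    exact hLarrow _
  have hLmesh : ∀ x z, T.tau x z → L.map (meshElement k T x z) = 0 := by
    intro x z hxz
    have hz := (h.tau_iff x z).1 hxz
    have hg : ∀ y, ¬ T.HasArrow x y →
        (∑ i : Fin (T.valTarget x y), arrow k i) ≫ ∑ j : Fin (T.valTarget y z), arrow k j = 0 := by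
      intro y hy
      have : T.valTarget x y = 0 := by simpa [HasArrow] using hy
      have : IsEmpty (Fin (T.valTarget x y)) := by rw [this]; infer_instance
      rw [Fintype.sum_empty, zero_comp]
    rw [h.meshElement_eq]
    rcases h.finsum_mesh hxz _ hg with ⟨h2, y, hy, hy', h3⟩ | ⟨h2, y, y', hy1, hy2, hy3, hy4, h3⟩
    · rw [h3, L.map_comp, hLsum _ _ ((h.hasArrow_iff _ _).2 (by omega)),
        hLsum _ _ ((h.hasArrow_iff _ _).2 (by omega))]
      exact InducedCategory.hom_ext (hφ1 x y z hxz h2 hy hy')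
    · rw [h3, L.map_add, L.map_comp, L.map_comp, hLsum _ _ ((h.hasArrow_iff _ _).2 (by omega)),
        hLsum _ _ ((h.hasArrow_iff _ _).2 (by omega)),
        hLsum _ _ ((h.hasArrow_iff _ _).2 (by omega)),
        hLsum _ _ ((h.hasArrow_iff _ _).2 (by omega))]
      exact InducedCategory.hom_ext (hφ2 x y y' z hxz hy1 hy2 hy3 hy4)
  have hLideal : ∀ a b (f g : a ⟶ b), meshRel k T f g → L.map f = L.map g := by
    intro a b f g hfg
    rw [← sub_eq_zero, ← L.map_sub]
    have : meshIdeal k T a b ≤ LinearMap.ker (L.mapLinearMap k (X := a) (Y := b)) := by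
      refine Submodule.span_le.2 ?_
      rintro _ ⟨x, z, p, q, hxz, rfl⟩
      rw [SetLike.mem_coe, LinearMap.mem_ker]
      change L.map (p ≫ meshElement k T x z ≫ q) = 0
      rw [L.map_comp, L.map_comp, hLmesh x z hxz, zero_comp, comp_zero]
    exact this hfg
  let F : MeshCat k T ⥤ InducedCategory C X := CategoryTheory.Quotient.lift _ L hLideal
  have hFL : ∀ {a b : PathCat k T} (f : a ⟶ b), F.map ((toMesh k T).map f) = L.map f :=
    fun f => rfl
  have hFadd : F.Additive := ⟨fun {a b f g} => by
    obtain ⟨f, rfl⟩ := (toMesh k T).map_surjective f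
    obtain ⟨g, rfl⟩ := (toMesh k T).map_surjective g
    exact L.map_add⟩
  have hFlin : F.Linear k := ⟨fun {a b} f c => by
    obtain ⟨f, rfl⟩ := (toMesh k T).map_surjective f
    exact L.map_smul c f⟩
  have hFarrow : ∀ x y, T.HasArrow x y → F.map (meshArrow k T x y) =
      (InducedCategory.homMk (φ x y) : o x ⟶ o y) := hLsum
  -- The image of `F` contains a nonzero map wherever one is expected. Induction on the distance: a
  -- last arrow is split off so that its source stays in the range, and `comp_ne_zero` applies.
  have hne : ∀ (n : ℕ) x y, α x ≤ α y → α y ≤ β x → β x ≤ β y →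
      α y - α x + (β y - β x) = n →
      ∃ f : meshObj k T x ⟶ meshObj k T y, F.map f ≠ 0 := by
    intro n
    induction n with
    | zero =>
      intro x y h1 h2 h3 hn
      obtain rfl : x = y := h.ext _ _ (by omega) (by omega)
      refine ⟨𝟙 _, fun h0 => hX.id_ne_zero x ?_⟩
      rw [F.map_id] at h0
      exact congrArg InducedCategory.Hom.hom h0
    | succ n ih =>
      intro x y h1 h2 h3 hn
      push_cast at hn
      obtain ⟨y', hy', h1', h2', h3', hn'⟩ : ∃ y', T.HasArrow y' y ∧ α x ≤ α y' ∧ α y' ≤ β x ∧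
          β x ≤ β y' ∧ α y' - α x + (β y' - β x) = n := by
        rcases h3.eq_or_lt with h3' | h3'
        · obtain ⟨y', h1', h2'⟩ := h.exists_eq (α y - 1) (β y)
            (h.ordConnected.out (h.left_mem x) (h.left_mem y) ⟨by omega, by omega⟩)
            (h.right_mem y) (by omega)
          exact ⟨y', (h.hasArrow_iff _ _).2 (by omega), by omega, by omega, by omega, by omega⟩
        · obtain ⟨y', h1', h2'⟩ := h.exists_eq (α y) (β y - 1) (h.left_mem y)
            (h.ordConnected.out (h.right_mem x) (h.right_mem y) ⟨by omega, by omega⟩) (by omega)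
          exact ⟨y', (h.hasArrow_iff _ _).2 (by omega), by omega, by omega, by omega, by omega⟩
      obtain ⟨f, hf⟩ := ih x y' h1' h2' h3' hn'
      refine ⟨f ≫ meshArrow k T y' y, fun h0 => ?_⟩
      rw [F.map_comp, hFarrow _ _ hy'] at h0
      exact hX.comp_ne_zero x y' y hy' h1' h2 h3' (F.map f).hom (φ y' y)
        (fun h => hf (InducedCategory.hom_ext h)) (hφ0 y' y hy')
        (congrArg InducedCategory.Hom.hom h0)
  have hfull : F.Full := ⟨fun {a b} g => by
    obtain ⟨x, rfl⟩ : ∃ x, meshObj k T x = a := ⟨a.as, rfl⟩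
    obtain ⟨y, rfl⟩ : ∃ y, meshObj k T y = b := ⟨b.as, rfl⟩
    by_cases hxy : α x ≤ α y ∧ α y ≤ β x ∧ β x ≤ β y
    · obtain ⟨f, hf⟩ := hne _ x y hxy.1 hxy.2.1 hxy.2.2 (Int.toNat_of_nonneg (by omega)).symm
      obtain ⟨z, hz⟩ := hX.exists_smul_eq x y (F.map f).hom g.hom
        (fun h => hf (InducedCategory.hom_ext h))
      exact ⟨z • f, (F.map_smul z f).trans (InducedCategory.hom_ext hz.symm)⟩
    · exact ⟨0, (F.map_zero _ _).trans (InducedCategory.hom_ext (hX.eq_zero x y hxy g.hom).symm)⟩⟩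
  have hfaithful : F.Faithful := by
    suffices hF0 : ∀ x y (f : meshObj k T x ⟶ meshObj k T y), F.map f = 0 → f = 0 from
      ⟨fun {a b f g} hfg => by
        obtain ⟨x, rfl⟩ : ∃ x, meshObj k T x = a := ⟨a.as, rfl⟩
        obtain ⟨y, rfl⟩ : ∃ y, meshObj k T y = b := ⟨b.as, rfl⟩
        exact sub_eq_zero.1 (hF0 x y (f - g) (F.map_sub.trans (sub_eq_zero.2 hfg)))⟩
    intro x y f hf
    -- In the range, `f` is a multiple of `s y`, and so is a morphism with nonzero image. Thus `s y`
    -- has nonzero image, and the scalar in front of it must vanish.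
    obtain ⟨s, -, hs, hs'⟩ := h.meshHom (k := k) x
    obtain ⟨z, rfl⟩ := hs' y f
    by_cases hxy : α x ≤ α y ∧ α y ≤ β x ∧ β x ≤ β y
    · obtain ⟨f, hf'⟩ := hne _ x y hxy.1 hxy.2.1 hxy.2.2 (Int.toNat_of_nonneg (by omega)).symm
      obtain ⟨z', rfl⟩ := hs' y f
      rw [F.map_smul] at hf hf'
      rcases smul_eq_zero.1 hf with h0 | h0
      · rw [h0, zero_smul]
      · exact absurd (by rw [h0, smul_zero]) hf'
    · rw [hs y hxy, smul_zero]
  have hess : F.EssSurj := ⟨fun x => ⟨meshObj k T x, ⟨Iso.refl _⟩⟩⟩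
  exact ⟨F, hFadd, hFlin, { }, fun x => rfl⟩

/-- Bottom vertices of a standard component. -/
theorem simple_homs_of_equivalence (h : T.IsIntervalShape J α β)
    (F : MeshCat k T ⥤ InducedCategory C X) (hF : F.Additive) (hF' : F.Linear k)
    (hF'' : F.IsEquivalence) (hobj : ∀ x : W, F.obj ⟨x⟩ = x) :
    (∀ x, α x = β x → ∀ f : X x ⟶ X x, ∃ z : k, f = z • 𝟙 (X x)) ∧
    ∀ x y, α x = β x → α y = β y → x ≠ y → ∀ f : X x ⟶ X y, f = 0 := by
  constructor
  · intro x hx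
    have key : ∀ f : F.obj ⟨x⟩ ⟶ F.obj ⟨x⟩, ∃ z : k, f = z • 𝟙 _ := by
      intro f
      obtain ⟨g, rfl⟩ := F.map_surjective f
      obtain ⟨s, hs, -, hs'⟩ := h.meshHom (k := k) x
      obtain ⟨z, rfl⟩ := hs' x g
      refine ⟨z, ?_⟩
      have := F.map_smul z (𝟙 (meshObj k T x))
      rw [F.map_id] at this
      rw [hs]
      exact this
    rw [hobj] at key
    intro f
    obtain ⟨z, hz⟩ := key (InducedCategory.homMk f)
    exact ⟨z, congrArg InducedCategory.Hom.hom hz⟩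
  · intro x y hx hy hxy
    have key : ∀ f : F.obj ⟨x⟩ ⟶ F.obj ⟨y⟩, f = 0 := by
      intro f
      obtain ⟨g, rfl⟩ := F.map_surjective f
      obtain ⟨s, -, hs, hs'⟩ := h.meshHom (k := k) x
      obtain ⟨z, rfl⟩ := hs' y g
      -- For `[a, a]` and `[c, c]` the range inequalities `a ≤ c ≤ a` force equality.
      rw [hs y (fun h' => hxy (h.ext _ _ (by omega) (by omega))), smul_zero]
      exact F.map_zero (meshObj k T x) (meshObj k T y)
    rw [hobj, hobj] at key
    intro f
    exact congrArg InducedCategory.Hom.hom (key (InducedCategory.homMk f))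

end ValuedTransQuiver

/-! ### Indecomposable objects and local endomorphism rings -/

section Indecomposable

variable {C : Type u} [Category.{v} C] [Preadditive C]

lemma isLocalRing_end_of_iso {X Y : C} (e : X ≅ Y) (hY : IsLocalRing (End Y)) :
    IsLocalRing (End X) := by
  have hX : Nontrivial (End X) := ⟨⟨𝟙 X, 0, fun h => id_ne_zero_of_isLocalRing Y (by
    rw [← e.inv_hom_id, ← Category.id_comp e.hom, show 𝟙 X = 0 from h, zero_comp, comp_zero])⟩⟩
  have key : ∀ a : X ⟶ X, IsUnit (End.of (e.inv ≫ a ≫ e.hom)) → IsUnit (End.of a) := by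
    intro a ha
    have : IsIso (e.inv ≫ a ≫ e.hom) := (isUnit_iff_isIso _).1 ha
    have h2 : a = e.hom ≫ (e.inv ≫ a ≫ e.hom) ≫ e.inv := by simp
    refine (isUnit_iff_isIso _).2 ?_
    change IsIso a
    rw [h2]
    infer_instance
  refine { isUnit_or_isUnit_of_add_one := fun {a b} hab => ?_ }
  refine (IsLocalRing.isUnit_or_isUnit_of_add_one (R := End Y) ?_).imp (key a) (key b)
  change e.inv ≫ a ≫ e.hom + e.inv ≫ b ≫ e.hom = 𝟙 Y
  rw [← Preadditive.comp_add, ← Preadditive.add_comp, show a + b = 𝟙 X from hab,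
    Category.id_comp, e.inv_hom_id]

variable [HasFiniteBiproducts C]

/-- A Krull-Schmidt decomposition has a first summand `Y 0`. By indecomposability the sum of the
others is zero, and `X` is isomorphic to `Y 0`. -/
lemma IsKrullSchmidt.isLocalRing_end (hKS : IsKrullSchmidt C) {X : C}
    (hX : IsIndecomposable X) : IsLocalRing (End X) := by
  classical
  have : HasBinaryBiproducts C := hasBinaryBiproducts_of_finite_biproducts C
  obtain ⟨n, Y, hY, ⟨θ⟩⟩ := hKS X hX.1
  cases n with
  | zero =>
    exfalso
    apply hX.1
    refine IsZero.of_iso ?_ θ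
    rw [IsZero.iff_id_eq_zero]
    ext j
    exact j.elim0
  | succ n =>
    let r : X ⟶ Y 0 := θ.hom ≫ biproduct.π Y 0
    let s : Y 0 ⟶ X := biproduct.ι Y 0 ≫ θ.inv
    let p := θ.hom ≫ biproduct.toSubtype Y (fun i => i ≠ 0)
    let i := biproduct.fromSubtype Y (fun i => i ≠ 0) ≫ θ.inv
    have hsr : s ≫ r = 𝟙 _ := by simp [s, r]
    have hip : i ≫ p = 𝟙 _ := by simp [i, p]
    have hsp : s ≫ p = 0 := by
      simp only [s, p, Category.assoc, Iso.inv_hom_id_assoc]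
      ext j
      simp
    have hir : i ≫ r = 0 := by
      simp only [i, r, Category.assoc, Iso.inv_hom_id_assoc]
      ext j
      simp
    have htot : r ≫ s + p ≫ i = 𝟙 X := by
      have : biproduct.π Y 0 ≫ biproduct.ι Y 0 + biproduct.toSubtype Y (fun i => i ≠ 0) ≫
          biproduct.fromSubtype Y (fun i => i ≠ 0) = 𝟙 _ := by
        rw [biproduct.toSubtype_fromSubtype]
        ext j l
        by_cases hj : j = 0
        · subst hj; simp
        · simp [hj, biproduct.ι_π_ne Y (Ne.symm hj)]
      have h2 := congrArg (fun t => θ.hom ≫ t ≫ θ.inv) this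
      simpa [r, s, p, i] using h2
    have hiso : X ≅ Y 0 ⊞ (⨁ Subtype.restrict (fun i => i ≠ 0) Y) :=
      { hom := biprod.lift r p
        inv := biprod.desc s i
        hom_inv_id := by simpa using htot
        inv_hom_id := by ext <;> simp [hsr, hip, hsp, hir] }
    have hK := (hX.2 _ _ hiso).resolve_left fun h =>
      @not_isZero_of_isLocalRing _ _ _ (Y 0) (hY 0) h
    refine isLocalRing_end_of_iso ⟨r, s, ?_, hsr⟩ (hY 0)
    rw [hK.eq_of_tgt p 0, zero_comp, add_zero] at htot
    exact htot

lemma isIndecomposable_of_isLocalRing {X : C} (hX : IsLocalRing (End X)) :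
    IsIndecomposable X := by
  have : HasBinaryBiproducts C := hasBinaryBiproducts_of_finite_biproducts C
  refine ⟨not_isZero_of_isLocalRing X, fun Y Z θ => ?_⟩
  have hsum : (θ.hom ≫ biprod.fst ≫ biprod.inl ≫ θ.inv) +
      (θ.hom ≫ biprod.snd ≫ biprod.inr ≫ θ.inv) = 𝟙 X := by
    have : θ.hom ≫ 𝟙 _ ≫ θ.inv = 𝟙 X := by simp
    rw [← biprod.total, Preadditive.add_comp, Preadditive.comp_add] at this
    simpa using this
  rcases IsLocalRing.isUnit_or_isUnit_of_add_one (R := End X) hsum with h | h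
  · right
    have : IsIso (θ.hom ≫ biprod.fst ≫ biprod.inl ≫ θ.inv) := (isUnit_iff_isIso _).1 h
    have h0 : (biprod.inr : Z ⟶ Y ⊞ Z) ≫ θ.inv = 0 := by
      rw [← cancel_mono (θ.hom ≫ biprod.fst ≫ biprod.inl ≫ θ.inv)]
      simp
    rw [IsZero.iff_id_eq_zero, ← biprod.inr_snd (X := Y), ← Category.comp_id biprod.inr,
      ← θ.inv_hom_id, ← Category.assoc, h0, zero_comp, zero_comp]
  · left
    have : IsIso (θ.hom ≫ biprod.snd ≫ biprod.inr ≫ θ.inv) := (isUnit_iff_isIso _).1 h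
    have h0 : (biprod.inl : Y ⟶ Y ⊞ Z) ≫ θ.inv = 0 := by
      rw [← cancel_mono (θ.hom ≫ biprod.snd ≫ biprod.inr ≫ θ.inv)]
      simp
    rw [IsZero.iff_id_eq_zero, ← biprod.inl_fst (Y := Z), ← Category.comp_id biprod.inl,
      ← θ.inv_hom_id, ← Category.assoc, h0, zero_comp, zero_comp]

end Indecomposable

/-! ### Automorphism fields and dimensions of spaces of irreducible morphisms -/

section Dimensions

lemma exists_generator_of_finrank_eq_one {R M : Type*} [Ring R] [Nontrivial R] [AddCommGroup M]
    [Module R M] (h : ∀ a : R, IsUnit a ∨ a = 0) (h1 : Module.finrank R M = 1) :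
    ∃ x : M, x ≠ 0 ∧ ∀ y, ∃ c : R, c • x = y := by
  let := DivisionRing.ofIsUnitOrEqZero h
  exact finrank_eq_one_iff'.1 h1

lemma finrank_pos_of_ne_zero {R M : Type*} [Ring R] [Nontrivial R] [AddCommGroup M]
    [Module R M] [Module.Finite R M] (h : ∀ a : R, IsUnit a ∨ a = 0) {x : M} (hx : x ≠ 0) :
    0 < Module.finrank R M := by
  let := DivisionRing.ofIsUnitOrEqZero h
  have : Nontrivial M := ⟨⟨x, 0, hx⟩⟩
  exact Module.finrank_pos

variable (k : Type w) [Field k] {C : Type u} [Category.{v} C] [Preadditive C] [Linear k C]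

/-- This lets finite dimension over `k` pass to finiteness over the automorphism field. -/
instance (X Y : C) : IsScalarTower k (AutField Y) (Irr k X Y) := ⟨fun c a f => by
  obtain ⟨a, rfl⟩ := Ideal.Quotient.mk_surjective a
  obtain ⟨f, rfl⟩ := Submodule.Quotient.mk_surjective _ f
  exact congrArg Submodule.Quotient.mk (Subtype.ext (Linear.comp_smul (C := C) _ _ _ f.1 c a))⟩

instance nontrivial_autField (X : C) [IsLocalRing (End X)] : Nontrivial (AutField X) :=
  Ideal.Quotient.nontrivial_iff.2 fun h => by
    have : (1 : End X) ∈ radIdeal X := h ▸ Submodule.mem_top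
    exact not_isRadical_of_comp_eq_id (Category.comp_id (𝟙 X)) (id_ne_zero_of_isLocalRing X) this

lemma isUnit_or_eq_zero_autField (X : C) [IsLocalRing (End X)] (a : AutField X) :
    IsUnit a ∨ a = 0 := by
  obtain ⟨f, rfl⟩ := Ideal.Quotient.mk_surjective a
  by_cases hf : IsRadical (show X ⟶ X from f)
  · exact Or.inr (Ideal.Quotient.eq_zero_iff_mem.2 hf)
  · left
    obtain ⟨r, hr⟩ := exists_comp_eq_id_of_not_isRadical hf
    obtain ⟨s, hs⟩ := exists_id_eq_comp_of_not_isRadical hf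
    have hrs : s = r := by rw [← Category.comp_id s, ← hr, ← Category.assoc, hs, Category.id_comp]
    refine IsUnit.map _ ⟨⟨f, r, ?_, hr⟩, rfl⟩
    exact hrs ▸ hs

variable {k}

lemma irr_mk_ne_zero {X Y : C} (f : rad k X Y) :
    (Submodule.Quotient.mk f : Irr k X Y) ≠ 0 ↔ f.1 ∉ radSq k X Y := by
  rw [ne_eq, Submodule.Quotient.mk_eq_zero]
  rfl

lemma exists_generator_source {X Y : C} [IsLocalRing (End X)] (h : irrDimSource k X Y = 1) :
    ∃ f₀ : X ⟶ Y, IsIrred k f₀ ∧ ∀ f : X ⟶ Y, IsRadical f →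
      ∃ ψ : X ⟶ X, f - ψ ≫ f₀ ∈ radSq k X Y := by
  obtain ⟨x, hx, hx'⟩ := exists_generator_of_finrank_eq_one (R := (AutField X)ᵐᵒᵖ)
    (fun a => (isUnit_or_eq_zero_autField X a.unop).imp (fun h => h.op)
      (fun h => MulOpposite.unop_injective h)) h
  obtain ⟨f₀, rfl⟩ := Submodule.Quotient.mk_surjective _ x
  refine ⟨f₀.1, ⟨f₀.2, (irr_mk_ne_zero f₀).1 hx⟩, fun f hf => ?_⟩
  obtain ⟨ψ, hψ⟩ := hx' (Submodule.Quotient.mk ⟨f, hf⟩)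
  obtain ⟨ψ, rfl⟩ := MulOpposite.op_surjective ψ
  obtain ⟨ψ, rfl⟩ := Ideal.Quotient.mk_surjective ψ
  rw [irrModuleSource_smul] at hψ
  exact ⟨ψ, (Submodule.Quotient.eq ((radSq k X Y).submoduleOf (rad k X Y))).1 hψ.symm⟩

/-- Hom-finiteness matters here: `finrank` would be zero on a space of infinite dimension, and the
irreducible map would not be seen as an arrow. -/
lemma IsIrred.irrDimTarget_pos {X Y : C} [FiniteDimensional k (X ⟶ Y)] [IsLocalRing (End Y)]
    {f : X ⟶ Y} (hf : IsIrred k f) : 0 < irrDimTarget k X Y := by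
  have : Module.Finite (AutField Y) (Irr k X Y) :=
    Module.Finite.of_restrictScalars_finite k (AutField Y) (Irr k X Y)
  exact finrank_pos_of_ne_zero (isUnit_or_eq_zero_autField Y)
    ((irr_mk_ne_zero (⟨f, hf.1⟩ : rad k X Y)).2 hf.2)

variable (k) in
/-- Every endomorphism of `X` is a scalar up to radical endomorphisms. -/
def EndTrivialModRad (X : C) : Prop := ∀ f : X ⟶ X, ∃ c : k, IsRadical (f - c • 𝟙 X)

lemma EndTrivialModRad.hasTrivialAutField {X : C} [IsLocalRing (End X)]
    (h : EndTrivialModRad k X) : HasTrivialAutField k X := by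
  refine ⟨(AlgEquiv.ofBijective (Algebra.ofId k (AutField X)) ⟨?_, ?_⟩).symm⟩
  · exact (algebraMap k (AutField X)).injective
  · intro a
    obtain ⟨f, rfl⟩ := Ideal.Quotient.mk_surjective a
    obtain ⟨c, hc⟩ := h f
    exact ⟨c, (Ideal.Quotient.eq.2 hc).symm⟩

/-- Triviality passes along an arrow of dimension one over the source. With a generator `f₀`, an
endomorphism `ψ` of `Y` can be moved to the source, where it is a scalar `c` modulo the radical. So
`f₀ ≫ (ψ - c)` lies in rad², and if `ψ - c` were not radical, `f₀` would lie there as well. -/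
lemma EndTrivialModRad.of_source {X Y : C} [IsLocalRing (End X)] [IsLocalRing (End Y)]
    (h : EndTrivialModRad k X) (hXY : irrDimSource k X Y = 1) : EndTrivialModRad k Y := by
  obtain ⟨f₀, hf₀, gen⟩ := exists_generator_source hXY
  intro ψ
  obtain ⟨φ, hφ⟩ := gen (f₀ ≫ ψ) (hf₀.1.comp_right ψ)
  obtain ⟨c, hc⟩ := h φ
  refine ⟨c, ?_⟩
  by_contra hψ
  obtain ⟨r, hr⟩ := exists_comp_eq_id_of_not_isRadical hψ
  have h1 : (φ - c • 𝟙 X) ≫ f₀ ∈ radSq k X Y := Submodule.subset_span ⟨X, _, _, hc, hf₀.1, rfl⟩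
  have h2 : f₀ ≫ (ψ - c • 𝟙 Y) ∈ radSq k X Y := by
    have := add_mem hφ h1
    rwa [show f₀ ≫ ψ - φ ≫ f₀ + (φ - c • 𝟙 X) ≫ f₀ = f₀ ≫ (ψ - c • 𝟙 Y) by
      simp [Preadditive.comp_sub, Preadditive.sub_comp]] at this
  have h3 := radSq_comp_right k r h2
  rw [Category.assoc, hr, Category.comp_id] at h3
  exact hf₀.2 h3

lemma EndTrivialModRad.exists_smul_sub_mem {X Y : C} [IsLocalRing (End X)]
    (h : EndTrivialModRad k X) (hXY : irrDimSource k X Y = 1) {f : X ⟶ Y} (hf : IsIrred k f)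
    {g : X ⟶ Y} (hg : IsRadical g) : ∃ c : k, g - c • f ∈ radSq k X Y := by
  obtain ⟨f₀, hf₀, gen⟩ := exists_generator_source hXY
  have gen' : ∀ g : X ⟶ Y, IsRadical g → ∃ c : k, g - c • f₀ ∈ radSq k X Y := by
    intro g hg
    obtain ⟨φ, hφ⟩ := gen g hg
    obtain ⟨c, hc⟩ := h φ
    refine ⟨c, ?_⟩
    have h1 : (φ - c • 𝟙 X) ≫ f₀ ∈ radSq k X Y :=
      Submodule.subset_span ⟨X, _, _, hc, hf₀.1, rfl⟩
    have := add_mem hφ h1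
    rwa [show g - φ ≫ f₀ + (φ - c • 𝟙 X) ≫ f₀ = g - c • f₀ by
      simp [Preadditive.sub_comp]] at this
  obtain ⟨c, hc⟩ := gen' f hf.1
  obtain ⟨d, hd⟩ := gen' g hg
  have hc0 : c ≠ 0 := by
    rintro rfl
    rw [zero_smul, sub_zero] at hc
    exact hf.2 hc
  refine ⟨d * c⁻¹, ?_⟩
  have := sub_mem hd (Submodule.smul_mem _ (d * c⁻¹) hc)
  rwa [smul_sub, smul_smul, inv_mul_cancel_right₀ hc0, sub_sub_sub_cancel_right] at this

lemma isBrick_of_forall_eq_smul {X : C} (hX : 𝟙 X ≠ 0)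
    (h : ∀ f : X ⟶ X, ∃ c : k, f = c • 𝟙 X) : IsBrick k X := by
  have : Nontrivial (End X) := ⟨⟨1, 0, hX⟩⟩
  refine ⟨(AlgEquiv.ofBijective (Algebra.ofId k (End X)) ⟨?_, ?_⟩).symm⟩
  · exact (algebraMap k (End X)).injective
  · intro f
    obtain ⟨c, hc⟩ := h f
    exact ⟨c, hc.symm⟩

lemma IsBrick.exists_eq_smul {X : C} (h : IsBrick k X) (f : X ⟶ X) : ∃ c : k, f = c • 𝟙 X := by
  obtain ⟨e⟩ := h
  refine ⟨e f, ?_⟩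
  apply e.injective
  change e f = e (e f • (1 : End X))
  rw [map_smul, map_one, smul_eq_mul, mul_one]

end Dimensions

open ValuedTransQuiver

variable {k : Type w} [Field k] {C : Type u} [Category.{v} C] [Preadditive C] [Linear k C]

lemma HasIntervalHoms.hasMeshHoms {W : Type*} {T : ValuedTransQuiver W} {J : Set ℤ}
    {α β : W → ℤ} {X : W → C} {E : ℤ → ℤ → C} (hE : HasIntervalHoms k E J)
    (h : T.IsIntervalShape J α β) (hX : ∀ x, E (α x) (β x) = X x) : HasMeshHoms k T α β X := by
  refine ⟨?_, ?_, ?_, ?_, ?_⟩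
  · intro x
    rw [← hX x]
    exact hE.id_ne_zero _ _ (h.left_mem x) (h.right_mem x) (h.le x)
  · intro x y hxy
    have hx := h.le x
    have hy := h.le y
    have ey := hX y
    have hy1 := h.left_mem y
    have hy2 := h.right_mem y
    rcases (h.hasArrow_iff x y).1 hxy with ⟨h1, h2⟩ | ⟨h1, h2⟩
    · rw [h1, h2] at ey
      rw [h2] at hy2
      rw [← hX x, ← ey]
      exact hE.right_ne_zero _ _ (h.left_mem x) (h.right_mem x) hy2 hx
    · rw [h1, h2] at ey
      rw [h1] at hy1
      rw [← hX x, ← ey]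
      exact hE.down_ne_zero _ _ (h.left_mem x) hy1 (h.right_mem x) (by omega)
  · intro x y hxy
    rw [← hX x, ← hX y]
    exact hE.eq_zero _ _ _ _ (h.left_mem x) (h.right_mem x) (h.left_mem y) (h.right_mem y)
      (h.le x) (h.le y) hxy
  · intro x y
    rw [← hX x, ← hX y]
    exact hE.exists_smul_eq _ _ _ _ (h.left_mem x) (h.right_mem x) (h.left_mem y) (h.right_mem y)
      (h.le x) (h.le y)
  · intro x y z hyz h1 h2 h3
    have hx := h.le x
    have hy := h.le y
    have hz := h.le z
    have ez := hX z
    have hz1 := h.left_mem z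
    have hz2 := h.right_mem z
    rcases (h.hasArrow_iff y z).1 hyz with ⟨h4, h5⟩ | ⟨h4, h5⟩
    · rw [h4, h5] at ez
      rw [h5] at hz2
      rw [← hX x, ← hX y, ← ez]
      exact hE.comp_right_ne_zero _ _ _ _ (h.left_mem x) (h.right_mem x) (h.left_mem y)
        (h.right_mem y) hz2 h1 (by omega) h3
    · rw [h4, h5] at ez
      rw [h4] at hz1
      rw [← hX x, ← hX y, ← ez]
      exact hE.comp_down_ne_zero _ _ _ _ (h.left_mem x) (h.right_mem x) (h.left_mem y)
        (h.right_mem y) hz1 h1 (by omega) h3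

/-! ### From a component with orthogonal quasi-simple bricks to its morphism spaces -/

section Component

variable {V : Set C} {Γ : Set V} {J : Set ℤ} {α β : Γ → ℤ}

lemma irrDimSource_eq_one (h : ((arQuiver k V).restrict Γ).IsIntervalShape J α β) {x y : Γ}
    (hxy : (α y = α x ∧ β y = β x + 1) ∨ (α y = α x + 1 ∧ β y = β x)) :
    irrDimSource k x.1.1 y.1.1 = 1 := by
  have := h.valSource_eq x y
  rwa [if_pos hxy] at this

/-- Induction along the right arrows `[a, a] → [a, a + 1] → ⋯`, starting from the brick at the
bottom. -/
lemma endTrivialModRad_of_shape (h : ((arQuiver k V).restrict Γ).IsIntervalShape J α β)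
    (hloc : ∀ x : Γ, IsLocalRing (End x.1.1))
    (hbrick : ∀ x : Γ, α x = β x → ∀ f : x.1.1 ⟶ x.1.1, ∃ c : k, f = c • 𝟙 _) (x : Γ) :
    EndTrivialModRad k x.1.1 := by
  obtain ⟨n, hn⟩ := Int.le.dest (h.le x)
  induction n generalizing x with
  | zero =>
    intro f
    obtain ⟨c, rfl⟩ := hbrick x (by simpa using hn) f
    exact ⟨c, by rw [sub_self]; exact isRadical_zero _ _⟩
  | succ n ih =>
    push_cast at hn
    obtain ⟨y, hy1, hy2⟩ := h.exists_eq (α x) (β x - 1) (h.left_mem x)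
      (h.ordConnected.out (h.left_mem x) (h.right_mem x) ⟨by omega, by omega⟩) (by omega)
    have := hloc x
    have := hloc y
    exact (ih y (by omega)).of_source (irrDimSource_eq_one h (by omega))

variable [HasFiniteBiproducts C]

/-- An irreducible map out of the component yields an arrow, so its target lies in the component.
This is what makes the arrows of the interval shape exhaust all irreducible maps, as source
morphisms require. -/
lemma exists_mem_of_isIrred (hfin : ∀ X Y : C, FiniteDimensional k (X ⟶ Y))
    (hV : IsCompleteSetOfIndecomposables V) (hΓ : (arQuiver k V).IsComponent Γ) (x : Γ) {M : C}
    (hM : IsLocalRing (End M)) {f : x.1.1 ⟶ M} (hf : IsIrred k f) :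
    ∃ y : Γ, ((arQuiver k V).restrict Γ).HasArrow x y ∧ Nonempty (M ≅ y.1.1) := by
  obtain ⟨Y, hY, ⟨θ⟩⟩ := hV.exists_iso M (isIndecomposable_of_isLocalRing hM)
  have hlocY : IsLocalRing (End Y) := isLocalRing_end_of_iso θ.symm hM
  have := hfin x.1.1 Y
  have hirr : IsIrred k (f ≫ θ.hom) := by
    refine ⟨hf.1.comp_right _, fun h' => hf.2 ?_⟩
    have := radSq_comp_right k θ.inv h'
    rwa [Category.assoc, θ.hom_inv_id, Category.comp_id] at this
  have harr : (arQuiver k V).HasArrow x.1 ⟨Y, hY⟩ := hirr.irrDimTarget_pos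
  have hmem : (⟨Y, hY⟩ : V) ∈ Γ := by
    obtain ⟨x₀, rfl⟩ := hΓ
    exact Relation.EqvGen.trans _ _ _ x.2 (Relation.EqvGen.rel _ _ harr)
  exact ⟨⟨⟨Y, hY⟩, hmem⟩, harr, ⟨θ⟩⟩

lemma isIntervalSystem_of_shape (hfin : ∀ X Y : C, FiniteDimensional k (X ⟶ Y))
    (hV : IsCompleteSetOfIndecomposables V) (hΓ : (arQuiver k V).IsComponent Γ)
    (h : ((arQuiver k V).restrict Γ).IsIntervalShape J α β)
    (hloc : ∀ x : Γ, IsLocalRing (End x.1.1))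
    (hbrick : ∀ x : Γ, α x = β x → ∀ f : x.1.1 ⟶ x.1.1, ∃ c : k, f = c • 𝟙 _)
    (horth : ∀ x y : Γ, α x = β x → α y = β y → x ≠ y → ∀ f : x.1.1 ⟶ y.1.1, f = 0)
    {E : ℤ → ℤ → C} (hE : ∀ x : Γ, E (α x) (β x) = x.1.1) (hE0 : ∀ a b, b < a → IsZero (E a b))
    {A B : ℤ} (hA : A ∈ J) (hB : B ∈ J) : IsIntervalSystem k E A B := by
  have mem : ∀ a, A ≤ a → a ≤ B → a ∈ J := fun a h1 h2 => h.ordConnected.out hA hB ⟨h1, h2⟩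
  have vert : ∀ a b, A ≤ a → a ≤ b → b ≤ B → ∃ x : Γ, α x = a ∧ β x = b ∧ E a b = x.1.1 := by
    intro a b h1 h2 h3
    obtain ⟨x, rfl, rfl⟩ := h.exists_eq a b (mem a h1 (by omega)) (mem b (by omega) h3) h2
    exact ⟨x, rfl, rfl, hE x⟩
  have triv := endTrivialModRad_of_shape h hloc hbrick
  refine ⟨hE0, ?_, ?_, ?_, ?_, ?_, ?_, ?_, ?_, ?_, ?_⟩
  · intro a b h1 h2 h3
    obtain ⟨x, -, -, ex⟩ := vert a b h1 h2 h3
    rw [ex]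
    exact hloc x
  · intro a b h1 h2 h3
    obtain ⟨x, hx1, hx2, ex⟩ := vert a (b + 1) h1 (by omega) h3
    rintro ⟨θ⟩
    rcases h2.eq_or_lt with rfl | h2
    · rw [ex] at θ
      have := hloc x
      exact not_isZero_of_isLocalRing _ ((hE0 _ _ (by omega)).of_iso θ)
    · obtain ⟨y, hy1, hy2, ey⟩ := vert (a + 1) b (by omega) (by omega) (by omega)
      rw [ex, ey] at θ
      have := hV.eq_of_iso _ x.1.2 _ y.1.2 ⟨θ⟩
      obtain rfl : x = y := Subtype.ext (Subtype.ext this)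
      omega
  · intro a b h1 h2 h3
    obtain ⟨x, hx1, hx2, ex⟩ := vert a b h1 h2 (by omega)
    obtain ⟨y, hy1, hy2, ey⟩ := vert a (b + 1) h1 (by omega) h3
    have := hloc x
    rw [ex, ey]
    obtain ⟨f, hf, -⟩ := exists_generator_source (irrDimSource_eq_one h (x := x) (y := y) (by omega))
    exact ⟨f, hf⟩
  · intro a b h1 h2 h3
    obtain ⟨x, hx1, hx2, ex⟩ := vert a b h1 h2 (by omega)
    obtain ⟨y, hy1, hy2, ey⟩ := vert a (b + 1) h1 (by omega) h3
    have := hloc x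
    rw [ex, ey]
    exact fun f g hf hg =>
      (triv x).exists_smul_sub_mem (irrDimSource_eq_one h (by omega)) hf hg
  · intro a b h1 h2 h3
    obtain ⟨x, hx1, hx2, ex⟩ := vert a b h1 h2.le h3
    obtain ⟨y, hy1, hy2, ey⟩ := vert (a + 1) b (by omega) h2 h3
    have := hloc x
    rw [ex, ey]
    obtain ⟨f, hf, -⟩ := exists_generator_source (irrDimSource_eq_one h (x := x) (y := y) (by omega))
    exact ⟨f, hf⟩
  · intro a b h1 h2 h3
    obtain ⟨x, hx1, hx2, ex⟩ := vert a b h1 h2.le h3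
    obtain ⟨y, hy1, hy2, ey⟩ := vert (a + 1) b (by omega) h2 h3
    have := hloc x
    rw [ex, ey]
    exact fun f g hf hg =>
      (triv x).exists_smul_sub_mem (irrDimSource_eq_one h (by omega)) hf hg
  · intro a b h1 h2 h3 M hM
    obtain ⟨x, hx1, hx2, ex⟩ := vert a b h1 h2 (by omega)
    rw [ex]
    intro f hf
    obtain ⟨y, hxy, hy⟩ := exists_mem_of_isIrred hfin hV hΓ x hM hf
    have ey := hE y
    rcases (h.hasArrow_iff x y).1 hxy with ⟨h4, h5⟩ | ⟨h4, h5⟩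
    · left
      rwa [← hx1, ← hx2, ← h4, ← h5, ey]
    · right
      rwa [← hx1, ← hx2, ← h4, ← h5, ey]
  · intro a b h1 h2 h3
    obtain ⟨x, hx1, hx2, ex⟩ := vert a b h1 h2 (by omega)
    obtain ⟨y, hy1, hy2, ey⟩ := vert (a + 1) (b + 1) (by omega) (by omega) h3
    rw [ex, ey]
    exact (h.tau_iff x y).2 (by omega)
  · intro a h1 h2
    obtain ⟨x, hx1, hx2, ex⟩ := vert a a h1 le_rfl h2
    rw [ex]
    exact hbrick x (by omega)
  · intro a b h1 h2 h3 h4 hab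
    obtain ⟨x, hx1, hx2, ex⟩ := vert a a h1 le_rfl h2
    obtain ⟨y, hy1, hy2, ey⟩ := vert b b h3 le_rfl h4
    rw [ex, ey]
    exact horth x y (by omega) (by omega) (by rintro rfl; omega)

theorem hasMeshHoms_of_shape (hfin : ∀ X Y : C, FiniteDimensional k (X ⟶ Y))
    (hKS : IsKrullSchmidt C)
    (hV : IsCompleteSetOfIndecomposables V) (hΓ : (arQuiver k V).IsComponent Γ)
    (h : ((arQuiver k V).restrict Γ).IsIntervalShape J α β)
    (hloc : ∀ x : Γ, IsLocalRing (End x.1.1))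
    (hbrick : ∀ x : Γ, α x = β x → ∀ f : x.1.1 ⟶ x.1.1, ∃ c : k, f = c • 𝟙 _)
    (horth : ∀ x y : Γ, α x = β x → α y = β y → x ≠ y → ∀ f : x.1.1 ⟶ y.1.1, f = 0) :
    HasMeshHoms k ((arQuiver k V).restrict Γ) α β (fun x : Γ => x.1.1) := by
  classical
  have : HasZeroObject C := hasZeroObject_of_hasFiniteBiproducts C
  obtain ⟨Z, hZ⟩ := HasZeroObject.zero (C := C)
  -- The family is extended to all pairs of integers by a zero object. Its values at `b < a` serve
  -- as the missing second middle term of the meshes at the bottom.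
  have hex : ∀ a b, ∃ Y : C, (∀ x : Γ, α x = a → β x = b → Y = x.1.1) ∧ (b < a → IsZero Y) := by
    intro a b
    by_cases hx : ∃ x : Γ, α x = a ∧ β x = b
    · obtain ⟨x, rfl, rfl⟩ := hx
      exact ⟨x.1.1, fun y h1 h2 => by rw [h.ext y x h1 h2], fun h' => absurd (h.le x) (by omega)⟩
    · exact ⟨Z, fun x h1 h2 => absurd ⟨x, h1, h2⟩ hx, fun _ => hZ⟩
  choose E hE hE0 using hex
  exact (HasIntervalHoms.of_Icc fun A B hA hB _ =>
    (isIntervalSystem_of_shape hfin hV hΓ h hloc hbrick horth (fun x => hE _ _ x rfl rfl) hE0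
      hA hB).hasIntervalHoms_Icc hKS).hasMeshHoms h (fun x => hE _ _ x rfl rfl)

end Component

end AR

theorem theorem1p8 {k : Type w} [Field k]
    {C : Type u} [Category.{v} C] [Preadditive C] [Linear k C] [HasFiniteBiproducts C]
    (hfin : ∀ X Y : C, FiniteDimensional k (X ⟶ Y)) (hKS : AR.IsKrullSchmidt C)
    (V : Set C) (hV : AR.IsCompleteSetOfIndecomposables V)
    (Γ : Set V) (hΓ : (AR.arQuiver k V).IsComponent Γ)
    (hshape : ((AR.arQuiver k V).restrict Γ).IsWing ∨
      ((AR.arQuiver k V).restrict Γ).IsAInfShape) :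
    AR.IsStandard k Γ ↔ AR.QuasiSimplesAreOrthogonalBricks k Γ := by
  obtain ⟨J, α, β, h, hqs⟩ := AR.ValuedTransQuiver.exists_isIntervalShape hshape
  have hloc : ∀ x : Γ, IsLocalRing (End x.1.1) := fun x =>
    hKS.isLocalRing_end (hV.indecomposable _ x.1.2)
  constructor
  · rintro ⟨-, F, hF, hF', hF'', hobj⟩
    obtain ⟨h1, h2⟩ := AR.ValuedTransQuiver.simple_homs_of_equivalence
      (X := fun x : Γ => x.1.1) h F hF hF' hF'' hobj
    refine ⟨fun X hX => ?_, fun X Y hX hY hXY => ⟨?_, ?_⟩⟩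
    · have := hloc X
      exact AR.isBrick_of_forall_eq_smul (AR.id_ne_zero_of_isLocalRing X.1.1)
        (h1 X ((hqs X).1 hX))
    · exact h2 X Y ((hqs X).1 hX) ((hqs Y).1 hY) hXY
    · exact h2 Y X ((hqs Y).1 hY) ((hqs X).1 hX) hXY.symm
  · rintro ⟨hbrick, horth⟩
    have hbrick' : ∀ x : Γ, α x = β x → ∀ f : x.1.1 ⟶ x.1.1, ∃ c : k, f = c • 𝟙 _ :=
      fun x hx f => (hbrick x ((hqs x).2 hx)).exists_eq_smul f
    have horth' : ∀ x y : Γ, α x = β x → α y = β y → x ≠ y → ∀ f : x.1.1 ⟶ y.1.1, f = 0 :=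
      fun x y hx hy hxy => (horth x y ((hqs x).2 hx) ((hqs y).2 hy) hxy).1
    refine ⟨fun x => ?_, ?_⟩
    · have := hloc x
      exact (AR.endTrivialModRad_of_shape h hloc hbrick' x).hasTrivialAutField
    · exact (AR.hasMeshHoms_of_shape hfin hKS hV hΓ h hloc hbrick' horth').exists_equivalence h
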